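/- Let $L$ be a natural number, let $d_0,\dots,d_L$ be natural numbers, and let $\mathbb{R}^{d_\theta}$, $d_\theta=\sum_{j=1}^L d_jd_{j-1}$, be the space of weight vectors $\theta=(W_L,\dots,W_1)$ with $W_j\in\mathbb{R}^{d_j\times d_{j-1}}$. Put $W_{k\sim i}=W_kW_{k-1}\cdots W_{i+1}$ for $L\ge k\ge i\ge 0$ (so $W_{i\sim i}=I$), with the conventions $W_{L+1\sim j}=0$ and $W_{j\sim -1}=0$. Let $\mu(\theta)=W_{L\sim 0}=W_L\cdots W_1$, let $\mathrm{d}\mu(\theta)$ be its differential at $\theta$, and let $\mu^{-1}(W)=\{\theta:\mu(\theta)=W\}$ be the fiber of a matrix $W\in\mathbb{R}^{d_L\times d_0}$. Fix $\theta\in\mu^{-1}(W)$ and a smoothness order $n\in\{1,2,\dots,\infty,\omega\}$. A *smooth path on the fiber leaving $\theta$ in the direction $\Delta\theta$* is a map $\gamma:[0,\hat\epsilon]\to\mu^{-1}(W)$, $\hat\epsilon>0$, of class $C^n$, with $\gamma(0)=\theta$, $\gamma'(0)=\Delta\theta$ and $\gamma'(t)\ne 0$ for all $t\in[0,\hat\epsilon]$.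 Then: 1. The set of directions $\Delta\theta$ by which a smooth path can leave $\theta$ on the fiber spans $\mathrm{null}\,\mathrm{d}\mu(\theta)=\{\Delta\theta:\mathrm{d}\mu(\theta)(\Delta\theta)=0\}$. 2. The maximum number of linearly independent directions by which smooth paths can leave $\theta$ on the fiber is $$D^{\mathrm{free}}=d_\theta-\sum_{j=1}^L\mathrm{rk}\,W_{L\sim j}\cdot\mathrm{rk}\,W_{j-1\sim 0}+\sum_{j=1}^{L-1}\mathrm{rk}\,W_{L\sim j}\cdot\mathrm{rk}\,W_{j\sim 0}.$$ 3. The spanning directions may be taken from straight one-matrix lines and from two-matrix paths, as follows. Let $A_{kji}=\mathrm{null}\,W_{k+1\sim j}\cap\mathrm{col}\,W_{j\sim i}$ and $B_{kji}=\mathrm{row}\,W_{k\sim j}\cap\mathrm{null}\,W_{j\sim i-1}^\top$. For $L\ge k\ge j\ge i\ge 0$ choose any subspaces $a_{kji},b_{kji}\subseteq\mathbb{R}^{d_j}$ with $$A_{kji}=a_{kji}\oplus(A_{k,j,i-1}+A_{k-1,j,i}),\qquad B_{kji}=b_{kji}\oplus(B_{k,j,i+1}+B_{k+1,j,i}).$$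 For subspaces $U,V$ write $U\otimes V$ for the space of matrices $M$ with $\mathrm{col}\,M\subseteq U$ and $\mathrm{row}\,M\subseteq V$. Let $\phi_{lkjih}=\{(0,\dots,0,M,0,\dots,0): M\in a_{lji}\otimes b_{k,j-1,h}\}$ ($M$ in the position of $W_j$) and $\tau_{lkjih}=\{(0,\dots,0,W_{j+1}H,-HW_j,0,\dots,0): H\in a_{lji}\otimes b_{kjh}\}$. Let $\Theta_{\mathrm{O}}^{\mathrm{fiber}}$ be the set of the nonzero $\phi_{lkjih}$ with $L\ge l\ge j\ge i\ge 0$, $L\ge k\ge j-1\ge h\ge 0$ and ($L>l$ or $h>0$); let $\Theta_{\mathrm{T}}^{L0}$ be the set of the nonzero $\tau_{Lkji0}$ with $L>j>0$ and $L\ge k\ge j\ge i\ge 0$; and let $\Theta^{\mathrm{free}}=\Theta_{\mathrm{O}}^{\mathrm{fiber}}\cup\Theta_{\mathrm{T}}^{L0}$. Then: - for every nonzero $\Delta\theta$ in a subspace of $\Theta_{\mathrm{O}}^{\mathrm{fiber}}$, at most one factor matrix of $\Delta\theta$ is nonzero, the whole line $\theta+\mathbb{R}\,\Delta\theta$ lies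 on the fiber, and $t\mapsto\theta+t\,\Delta\theta$, $t\in[0,\hat\epsilon]$, is for every $\hat\epsilon>0$ a smooth path on the fiber leaving $\theta$ in the direction $\Delta\theta$; - for every nonzero $\Delta\theta$ in a subspace of $\Theta_{\mathrm{T}}^{L0}$ there are $j\in[1,L-1]$, a $d_j\times d_j$ matrix $H$ and $\hat\epsilon>0$ such that $I+tH$ is invertible for all $t\in[0,\hat\epsilon]$ and the two-matrix path $t\mapsto(W_L,\dots,W_{j+2},W_{j+1}(I+tH),(I+tH)^{-1}W_j,W_{j-1},\dots,W_1)$, $t\in[0,\hat\epsilon]$, is a smooth path on the fiber leaving $\theta$ in the direction $\Delta\theta$; - the sum of the subspaces in $\Theta^{\mathrm{free}}$ is $\mathrm{null}\,\mathrm{d}\mu(\theta)$, and its dimension is $D^{\mathrm{free}}$. -/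

import Mathlib

-- Any norm on a finite-dimensional space of matrices induces the same derivatives and the same
-- `C^n` maps; we use the entrywise supremum norm.
attribute [local instance] Matrix.normedAddCommGroup Matrix.normedSpace

noncomputable section

namespace LinearNetwork

open Set Matrix

/-- The weight space of a linear network with `L` factor matrices and unit layers `0, …, L` of
sizes `d 0, …, d L` (the values `d j` with `j > L` play no role).  For `θ = (W_L, …, W_1)`,
the entry `θ p` is the `d (p + 1) × d p` matrix `W_{p+1}`. -/
abbrev Weights (L : ℕ) (d : ℕ → ℕ) : Type :=
  (p : Fin L) → Matrix (Fin (d (p + 1))) (Fin (d p)) ℝ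

variable {L : ℕ} {d : ℕ → ℕ}

/-- The factor matrix `W_{p+1}`, extended by `0` for `p ≥ L` (so that `W_{L+1} = 0`). -/
def factor (θ : Weights L d) (p : ℕ) : Matrix (Fin (d (p + 1))) (Fin (d p)) ℝ :=
  if h : p < L then θ ⟨p, h⟩ else 0

/-- The `m × n` matrix with ones on the diagonal and zeros elsewhere (the identity if `m = n`). -/
def diagOnes (m n : ℕ) : Matrix (Fin m) (Fin n) ℝ :=
  Matrix.of fun r c => if (r : ℕ) = (c : ℕ) then 1 else 0

/-- The subsequence matrix `W_{k∼i} = W_k W_{k-1} ⋯ W_{i+1}` for `k ≥ i`, with `W_{i∼i} = I` and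
`W_{L+1∼i} = 0`. (It is `0` in the meaningless case `k < i`.) -/
def subseq (θ : Weights L d) (i : ℕ) : (k : ℕ) → Matrix (Fin (d k)) (Fin (d i)) ℝ
  | 0 => if i = 0 then diagOnes (d 0) (d i) else 0
  | k + 1 => if i = k + 1 then diagOnes (d (k + 1)) (d i) else factor θ k * subseq θ i k

/-- The matrix multiplication map `μ(θ) = W_L ⋯ W_1`. -/
def mu (θ : Weights L d) : Matrix (Fin (d L)) (Fin (d 0)) ℝ := subseq θ 0 L

/-- The fiber `μ⁻¹(W)`. -/
def fiber (W : Matrix (Fin (d L)) (Fin (d 0)) ℝ) : Set (Weights L d) := {θ | mu θ = W}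

/-- The nullspace of the differential `dμ(θ)` of `μ` at `θ`. -/
def nullDmu (θ : Weights L d) : Submodule ℝ (Weights L d) :=
  LinearMap.ker (fderiv ℝ (mu (L := L) (d := d)) θ).toLinearMap

/-! ### Smooth paths on the fiber -/

/-- `γ : [0, ε] → μ⁻¹(W)` is a `C^n` path with nowhere vanishing velocity (so that it has a
well-defined tangent line at each of its points) that lies on the fiber and leaves `θ = γ 0`
in the direction `Δ = γ' 0`. -/
structure IsFiberPath (n : WithTop ℕ∞) (W : Matrix (Fin (d L)) (Fin (d 0)) ℝ)
    (θ Δ : Weights L d) (ε : ℝ) (γ : ℝ → Weights L d) : Prop where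
  pos : 0 < ε
  smooth : ContDiffOn ℝ n γ (Icc 0 ε)
  regular : ∀ t ∈ Icc 0 ε, derivWithin γ (Icc 0 ε) t ≠ 0
  mem_fiber : ∀ t ∈ Icc 0 ε, γ t ∈ fiber W
  start : γ 0 = θ
  direction : HasDerivWithinAt γ Δ (Icc 0 ε) 0

/-- The set of directions by which a `C^n` path can leave `θ` on the fiber `μ⁻¹(W)`. -/
def directions (n : WithTop ℕ∞) (W : Matrix (Fin (d L)) (Fin (d 0)) ℝ) (θ : Weights L d) :
    Set (Weights L d) :=
  {Δ | ∃ (ε : ℝ) (γ : ℝ → Weights L d), IsFiberPath n W θ Δ ε γ}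

/-- `Δ` is the direction of a straight one-matrix line on the fiber: at most one factor matrix
of `Δ` is nonzero, the whole line `θ + ℝ Δ` lies on the fiber, and its initial pieces are
`C^n` paths leaving `θ` in the direction `Δ`. -/
def IsOneMatrixDirection (n : WithTop ℕ∞) (W : Matrix (Fin (d L)) (Fin (d 0)) ℝ)
    (θ Δ : Weights L d) : Prop :=
  (∃ p : Fin L, ∀ q : Fin L, q ≠ p → Δ q = 0) ∧
  (∀ t : ℝ, θ + t • Δ ∈ fiber W) ∧
  ∀ ε : ℝ, 0 < ε → IsFiberPath n W θ Δ ε (fun t => θ + t • Δ)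

/-- The two-matrix move at the hidden layer `j = p + 1`, `1 ≤ j ≤ L - 1`: replace `W_{j+1}` by
`W_{j+1} M` and `W_j` by `M⁻¹ W_j`. -/
def twoMatrixMove (θ : Weights L d) (p : ℕ) (hp : p + 1 < L)
    (M : Matrix (Fin (d (p + 1))) (Fin (d (p + 1))) ℝ) : Weights L d :=
  Function.update
    (Function.update θ ⟨p + 1, hp⟩ (factor θ (p + 1) * M))
    ⟨p, Nat.lt_of_succ_lt hp⟩ (M⁻¹ * factor θ p)

/-- `Δ` is the direction of a two-matrix path
`ε ↦ (W_L, …, W_{j+1} (I + ε H), (I + ε H)⁻¹ W_j, …, W_1)` on the fiber. -/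
def IsTwoMatrixDirection (n : WithTop ℕ∞) (W : Matrix (Fin (d L)) (Fin (d 0)) ℝ)
    (θ Δ : Weights L d) : Prop :=
  ∃ (p : ℕ) (hp : p + 1 < L) (H : Matrix (Fin (d (p + 1))) (Fin (d (p + 1))) ℝ) (ε : ℝ),
    (∀ t ∈ Icc 0 ε, IsUnit (1 + t • H)) ∧
    IsFiberPath n W θ Δ ε (fun t => twoMatrixMove θ p hp (1 + t • H))

/-! ### Flow subspaces and prebases -/

/-- The nullspace of a matrix. -/
def null {m n : ℕ} (M : Matrix (Fin m) (Fin n) ℝ) : Submodule ℝ (Fin n → ℝ) :=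
  LinearMap.ker M.mulVecLin

/-- The columnspace of a matrix. -/
def col {m n : ℕ} (M : Matrix (Fin m) (Fin n) ℝ) : Submodule ℝ (Fin m → ℝ) :=
  LinearMap.range M.mulVecLin

/-- `col W_{j∼i-1}`, with the convention that it is `{0}` for `i = 0`. -/
def colPrev (θ : Weights L d) (j : ℕ) : ℕ → Submodule ℝ (Fin (d j) → ℝ)
  | 0 => ⊥
  | i + 1 => col (subseq θ i j)

/-- `null W_{j∼i-1}ᵀ`, with the convention that it is the whole space for `i = 0`. -/
def leftNullPrev (θ : Weights L d) (j : ℕ) : ℕ → Submodule ℝ (Fin (d j) → ℝ)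
  | 0 => ⊤
  | i + 1 => null (subseq θ i j)ᵀ

/-- The flow subspace `A_{k-1,j,i-1} = null W_{k∼j} ∩ col W_{j∼i-1}`.  Note the shift by one in
`k` and `i`, which lets the indices `k - 1 = j - 1` and `i - 1 = -1` be natural numbers. -/
def flowA (θ : Weights L d) (k j i : ℕ) : Submodule ℝ (Fin (d j) → ℝ) :=
  null (subseq θ j k) ⊓ colPrev θ j i

/-- The flow subspace `B_{k,j,i} = row W_{k∼j} ∩ null W_{j∼i-1}ᵀ` (no shift of indices). -/
def flowB (θ : Weights L d) (k j i : ℕ) : Submodule ℝ (Fin (d j) → ℝ) :=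
  col (subseq θ j k)ᵀ ⊓ leftNullPrev θ j i

/-- `Z ↓ Y`: the set of subspaces `X` with `Z = X ⊕ Y`. -/
def relCompl {m : ℕ} (Z Y : Submodule ℝ (Fin m → ℝ)) : Set (Submodule ℝ (Fin m → ℝ)) :=
  {X | X ⊔ Y = Z ∧ X ⊓ Y = ⊥}

/-- `a k j i` and `b k j i` are prebasis subspaces at `θ`: for `L ≥ k ≥ j ≥ i ≥ 0`,
`a_{kji} ∈ A_{kji} ↓ (A_{k,j,i-1} + A_{k-1,j,i})` and
`b_{kji} ∈ B_{kji} ↓ (B_{k,j,i+1} + B_{k+1,j,i})`. -/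
def IsPrebasisChoice (θ : Weights L d) (a b : ℕ → (j : ℕ) → ℕ → Submodule ℝ (Fin (d j) → ℝ)) :
    Prop :=
  ∀ k j i : ℕ, k ≤ L → j ≤ k → i ≤ j →
    a k j i ∈ relCompl (flowA θ (k + 1) j (i + 1)) (flowA θ (k + 1) j i ⊔ flowA θ k j (i + 1)) ∧
    b k j i ∈ relCompl (flowB θ k j i) (flowB θ k j (i + 1) ⊔ flowB θ (k + 1) j i)

/-- `U ⊗ V`: the matrices `M` with `col M ⊆ U` and `row M ⊆ V`. -/
def tensor {m n : ℕ} (U : Submodule ℝ (Fin m → ℝ)) (V : Submodule ℝ (Fin n → ℝ)) :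
    Submodule ℝ (Matrix (Fin m) (Fin n) ℝ) where
  carrier := {M | (∀ x, M *ᵥ x ∈ U) ∧ ∀ y, Mᵀ *ᵥ y ∈ V}
  add_mem' := by
    rintro M N ⟨h₁, h₂⟩ ⟨h₃, h₄⟩
    refine ⟨fun x => ?_, fun y => ?_⟩
    · rw [Matrix.add_mulVec]; exact U.add_mem (h₁ x) (h₃ x)
    · rw [Matrix.transpose_add, Matrix.add_mulVec]; exact V.add_mem (h₂ y) (h₄ y)
  zero_mem' := by simp
  smul_mem' := by
    rintro c M ⟨h₁, h₂⟩
    refine ⟨fun x => ?_, fun y => ?_⟩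
    · rw [Matrix.smul_mulVec]; exact U.smul_mem c (h₁ x)
    · rw [Matrix.transpose_smul, Matrix.smul_mulVec]; exact V.smul_mem c (h₂ y)

/-- The one-matrix subspace
`φ_{l,k,j,i,h} = {(0, …, 0, M, 0, …, 0) : M ∈ a_{l,j,i} ⊗ b_{k,j-1,h}}` with `j = p + 1`. -/
def phi (a b : ℕ → (j : ℕ) → ℕ → Submodule ℝ (Fin (d j) → ℝ))
    (l k : ℕ) (p : Fin L) (i h : ℕ) : Submodule ℝ (Weights L d) :=
  (tensor (a l (p + 1) i) (b k p h)).map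
    (LinearMap.single ℝ (fun q : Fin L => Matrix (Fin (d (q + 1))) (Fin (d q)) ℝ) p)

/-- The linear map `H ↦ (0, …, 0, W_{j+1} H, -H W_j, 0, …, 0)` with `j = p + 1`. -/
def twoMatrixTangent (θ : Weights L d) (p : ℕ) (hp : p + 1 < L) :
    Matrix (Fin (d (p + 1))) (Fin (d (p + 1))) ℝ →ₗ[ℝ] Weights L d where
  toFun H := Pi.single ⟨p + 1, hp⟩ (factor θ (p + 1) * H) -
    Pi.single ⟨p, Nat.lt_of_succ_lt hp⟩ (H * factor θ p)
  map_add' H K := by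
    rw [Matrix.mul_add, Matrix.add_mul, Pi.single_add, Pi.single_add]; abel
  map_smul' c H := by
    rw [Matrix.mul_smul, Matrix.smul_mul, Pi.single_smul, Pi.single_smul, smul_sub]; rfl

/-- The two-matrix subspace
`τ_{l,k,j,i,h} = {(0, …, 0, W_{j+1} H, -H W_j, 0, …, 0) : H ∈ a_{l,j,i} ⊗ b_{k,j,h}}`
with `j = p + 1`. -/
def tau (θ : Weights L d) (a b : ℕ → (j : ℕ) → ℕ → Submodule ℝ (Fin (d j) → ℝ))
    (l k p : ℕ) (hp : p + 1 < L) (i h : ℕ) : Submodule ℝ (Weights L d) :=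
  (tensor (a l (p + 1) i) (b k (p + 1) h)).map (twoMatrixTangent θ p hp)

/-- `Θ_O^fiber`: the nonzero subspaces `φ_{l,k,j,i,h}` with `L ≥ l ≥ j ≥ i ≥ 0`,
`L ≥ k ≥ j - 1 ≥ h ≥ 0`, and `L > l` or `h > 0`. -/
def thetaOFiber (L : ℕ) {d : ℕ → ℕ} (a b : ℕ → (j : ℕ) → ℕ → Submodule ℝ (Fin (d j) → ℝ)) :
    Set (Submodule ℝ (Weights L d)) :=
  {X | X ≠ ⊥ ∧ ∃ (l k : ℕ) (p : Fin L) (i h : ℕ),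
    (l ≤ L ∧ (p : ℕ) + 1 ≤ l ∧ i ≤ (p : ℕ) + 1) ∧ (k ≤ L ∧ (p : ℕ) ≤ k ∧ h ≤ (p : ℕ)) ∧
    (l < L ∨ 0 < h) ∧ X = phi a b l k p i h}

/-- `Θ_T^{L0}`: the nonzero subspaces `τ_{L,k,j,i,0}` with `L > j > 0` and
`L ≥ k ≥ j ≥ i ≥ 0`. -/
def thetaTL0 (θ : Weights L d) (a b : ℕ → (j : ℕ) → ℕ → Submodule ℝ (Fin (d j) → ℝ)) :
    Set (Submodule ℝ (Weights L d)) :=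
  {X | X ≠ ⊥ ∧ ∃ (k p : ℕ) (hp : p + 1 < L) (i : ℕ),
    k ≤ L ∧ p + 1 ≤ k ∧ i ≤ p + 1 ∧ X = tau θ a b L k p hp i 0}

/-- The freedom prebasis `Θ^free = Θ_O^fiber ∪ Θ_T^{L0}`. -/
def thetaFree (θ : Weights L d) (a b : ℕ → (j : ℕ) → ℕ → Submodule ℝ (Fin (d j) → ℝ)) :
    Set (Submodule ℝ (Weights L d)) :=
  thetaOFiber L a b ∪ thetaTL0 θ a b

/-- `D^free = ∑_{j=1}^L d_j d_{j-1} - ∑_{j=1}^L rk W_{L∼j} · rk W_{j-1∼0}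
+ ∑_{j=1}^{L-1} rk W_{L∼j} · rk W_{j∼0}`. -/
def dFree (θ : Weights L d) : ℤ :=
  (∑ p ∈ Finset.range L, (d (p + 1) : ℤ) * d p)
    - (∑ p ∈ Finset.range L, ((subseq θ (p + 1) L).rank : ℤ) * (subseq θ 0 p).rank)
    + ∑ j ∈ Finset.Ico 1 L, ((subseq θ j L).rank : ℤ) * (subseq θ 0 j).rank

end LinearNetwork

end

noncomputable section

namespace LinearNetwork

open Set Matrix

variable {L : ℕ} {d : ℕ → ℕ}

/-! Write `dμ(θ)(Δ) = ∑ W_{L∼j} Δ_j W_{j-1∼0}`. Both the dimension and the generators of its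
nullspace come from one fact about the images `R_j = {W_{L∼j} M W_{j-1∼0}}` of the single blocks:
for `j ≥ 1`, the intersection of `R_1 + ⋯ + R_j` with `R_{j+1}` is `{W_{L∼j} H W_{j∼0}}`
(`partialRange_inf_moveRange`). A matrix in the intersection has its columns in `col W_{L∼j}` and
its rows in `row W_{j∼0}`, so it factors through both.

Since `M ↦ X M Y` has rank `rk X · rk Y` (`finrank_range_sandwich`), inclusion–exclusion gives the
rank of `dμ(θ)`, and rank–nullity gives `D^free` (`finrank_nullDmu`). The same intersection allows
the last nonzero block of a null vector to be cancelled by a two-matrix tangent and a one-matrix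
null vector; by induction these two kinds generate the nullspace (`nullDmu_le`).

Both kinds are velocities of paths on the fiber: `μ` is affine in each factor, and `W_{j+1}(I +
tH)`, `(I + tH)⁻¹ W_j` have constant product. Conversely `μ` is constant along a path on the fiber,
so its velocity is null. This gives `span_directions`, and the maximal number of independent
directions is the dimension of the span.

For the prebasis, unrolling the recursions for `A_{kji}` and `B_{kji}` shows that the `a_{kji}` with
`k < L` fill `null W_{L∼j}`, the `b_{kji}` with `i > 0` fill `null W_{j∼0}ᵀ`, and each full family
fills `ℝ^{d_j}`. Rank-one matrices then carry this over to the `φ` and `τ` subspaces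
(`sSup_thetaFree`). -/

/-! ### Linear algebra of matrices -/

/-- Every real matrix has a generalized inverse. -/
lemma exists_mul_mul_eq_self {m n : ℕ} (X : Matrix (Fin m) (Fin n) ℝ) :
    ∃ G : Matrix (Fin n) (Fin m) ℝ, X * G * X = X := by
  obtain ⟨s, hs⟩ := (toLin' X).rangeRestrict.exists_rightInverse_of_surjective
    (LinearMap.range_rangeRestrict _)
  -- `G` is a section of `X` over its range, extended arbitrarily to the whole space.
  obtain ⟨g, hg⟩ := LinearMap.exists_extend s
  refine ⟨LinearMap.toMatrix' g, toLin'.injective ?_⟩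
  rw [toLin'_mul, toLin'_mul, toLin'_toMatrix']
  ext1 x
  ext1
  have h1 : g (toLin' X (Pi.single x 1)) = s ((toLin' X).rangeRestrict (Pi.single x 1)) :=
    LinearMap.congr_fun hg ((toLin' X).rangeRestrict (Pi.single x 1))
  have h2 := congrArg Subtype.val
    (LinearMap.congr_fun hs ((toLin' X).rangeRestrict (Pi.single x 1)))
  simp only [LinearMap.comp_apply, LinearMap.coe_single] at h1 h2 ⊢
  rw [h1]
  exact h2

/-- The linear map `M ↦ X M Y`. -/
def sandwich {k l m n : ℕ} (X : Matrix (Fin k) (Fin l) ℝ) (Y : Matrix (Fin m) (Fin n) ℝ) :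
    Matrix (Fin l) (Fin m) ℝ →ₗ[ℝ] Matrix (Fin k) (Fin n) ℝ where
  toFun M := X * M * Y
  map_add' M N := by rw [Matrix.mul_add, Matrix.add_mul]
  map_smul' c M := by rw [Matrix.mul_smul, Matrix.smul_mul]; rfl

lemma sandwich_apply {k l m n : ℕ} (X : Matrix (Fin k) (Fin l) ℝ) (Y : Matrix (Fin m) (Fin n) ℝ)
    (M : Matrix (Fin l) (Fin m) ℝ) : sandwich X Y M = X * M * Y := rfl

/-- `X M Y` depends only on the map that `M` induces from the range of `Y` to the range of `X`, and
every linear map between these ranges occurs. The range is thus a copy of `Hom(col Y, col X)`. -/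
lemma finrank_range_sandwich {k l m n : ℕ} (X : Matrix (Fin k) (Fin l) ℝ)
    (Y : Matrix (Fin m) (Fin n) ℝ) :
    Module.finrank ℝ (LinearMap.range (sandwich X Y)) = X.rank * Y.rank := by
  let C := LinearMap.range (toLin' X)
  let D := LinearMap.range (toLin' Y)
  let Ψ : (D →ₗ[ℝ] C) →ₗ[ℝ] Matrix (Fin k) (Fin n) ℝ :=
    LinearMap.toMatrix'.toLinearMap ∘ₗ
      (LinearMap.lcomp ℝ (Fin k → ℝ) (toLin' Y).rangeRestrict) ∘ₗ
      (LinearMap.llcomp ℝ D C (Fin k → ℝ) C.subtype)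
  have hΨ : ∀ g, Ψ g = LinearMap.toMatrix' (C.subtype ∘ₗ g ∘ₗ (toLin' Y).rangeRestrict) :=
    fun g => rfl
  have hinj : Function.Injective Ψ := by
    intro g g' h
    rw [hΨ, hΨ] at h
    have h' := LinearMap.toMatrix'.injective h
    ext1 ⟨x, y, hy⟩
    have := LinearMap.congr_fun h' y
    simp only [LinearMap.comp_apply] at this
    have h3 := C.injective_subtype this
    have h4 : (toLin' Y).rangeRestrict y = ⟨x, y, hy⟩ := Subtype.ext hy
    rwa [h4] at h3
  have hrange : LinearMap.range Ψ = LinearMap.range (sandwich X Y) := by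
    apply le_antisymm
    · rintro _ ⟨g, rfl⟩
      obtain ⟨s, hs⟩ := (toLin' X).rangeRestrict.exists_rightInverse_of_surjective
        (LinearMap.range_rangeRestrict _)
      -- To realize `g` by a matrix, lift its values through a section of `X`, then extend from the
      -- range of `Y` to the whole space.
      obtain ⟨g', hg'⟩ := LinearMap.exists_extend (s ∘ₗ g)
      refine ⟨LinearMap.toMatrix' g', ?_⟩
      rw [sandwich_apply, hΨ]
      apply toLin'.injective
      rw [toLin'_mul, toLin'_mul, toLin'_toMatrix', toLin'_toMatrix']
      refine LinearMap.ext fun y => ?_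
      have h1 : g' (toLin' Y y) = s (g ((toLin' Y).rangeRestrict y)) :=
        LinearMap.congr_fun hg' ((toLin' Y).rangeRestrict y)
      have h2 := congrArg Subtype.val
        (LinearMap.congr_fun hs (g ((toLin' Y).rangeRestrict y)))
      simp only [LinearMap.comp_apply] at h2 ⊢
      rw [h1]
      exact h2
    · rintro _ ⟨M, rfl⟩
      refine ⟨(toLin' X).rangeRestrict ∘ₗ toLin' M ∘ₗ D.subtype, ?_⟩
      rw [sandwich_apply, hΨ]
      apply toLin'.injective
      rw [toLin'_mul, toLin'_mul, toLin'_toMatrix']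
      rfl
  rw [← hrange, LinearMap.finrank_range_of_inj hinj, Module.finrank_linearMap, mul_comm]
  rfl

/-- A matrix in the column space of `X` and in the row space of `Y` has the form `X H Y`. -/
lemma mem_range_sandwich {k l m n : ℕ} {X : Matrix (Fin k) (Fin l) ℝ}
    {Y : Matrix (Fin m) (Fin n) ℝ} {E : Matrix (Fin k) (Fin n) ℝ}
    (h₁ : ∃ Z : Matrix (Fin l) (Fin n) ℝ, E = X * Z)
    (h₂ : ∃ Z : Matrix (Fin k) (Fin m) ℝ, E = Z * Y) : E ∈ LinearMap.range (sandwich X Y) := by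
  obtain ⟨Z, hZ⟩ := h₁
  obtain ⟨Z', hZ'⟩ := h₂
  obtain ⟨G, hG⟩ := exists_mul_mul_eq_self X
  obtain ⟨K, hK⟩ := exists_mul_mul_eq_self Y
  -- `X G` fixes `E = X Z` on the left and `K Y` fixes `E = Z' Y` on the right.
  refine ⟨G * E * K, ?_⟩
  have e₁ : X * (G * E) = E := by
    rw [hZ, ← Matrix.mul_assoc, ← Matrix.mul_assoc, hG]
  have e₂ : E * K * Y = E := by rw [hZ', Matrix.mul_assoc, Matrix.mul_assoc, ← Matrix.mul_assoc Y, hK]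
  rw [sandwich_apply, ← Matrix.mul_assoc, e₁, e₂]

lemma vecMulVec_mem_tensor {m n : ℕ} {U : Submodule ℝ (Fin m → ℝ)} {V : Submodule ℝ (Fin n → ℝ)}
    {u : Fin m → ℝ} {v : Fin n → ℝ} (hu : u ∈ U) (hv : v ∈ V) : vecMulVec u v ∈ tensor U V := by
  refine ⟨fun x => ?_, fun y => ?_⟩
  · have : vecMulVec u v *ᵥ x = (v ⬝ᵥ x) • u := by
      ext i; simp [vecMulVec_mulVec, mul_comm]
    rw [this]; exact U.smul_mem _ hu
  · have : (vecMulVec u v)ᵀ *ᵥ y = (u ⬝ᵥ y) • v := by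
      ext i; simp [transpose_vecMulVec, vecMulVec_mulVec, mul_comm]
    rw [this]; exact V.smul_mem _ hv

/-- The rank-one matrices with fixed row `v`. -/
def vecMulVecLeft (m : ℕ) {n : ℕ} (v : Fin n → ℝ) :
    (Fin m → ℝ) →ₗ[ℝ] Matrix (Fin m) (Fin n) ℝ where
  toFun u := vecMulVec u v
  map_add' u u' := add_vecMulVec u u' v
  map_smul' c u := smul_vecMulVec c u v

/-- The rank-one matrices with fixed column `u`. -/
def vecMulVecRight {m : ℕ} (n : ℕ) (u : Fin m → ℝ) :
    (Fin n → ℝ) →ₗ[ℝ] Matrix (Fin m) (Fin n) ℝ where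
  toFun v := vecMulVec u v
  map_add' v v' := vecMulVec_add u v v'
  map_smul' c v := vecMulVec_smul c u v

/-- A matrix is the sum over `c` of its `c`-th column times the row `e_c`, so membership can be
tested on rank-one matrices. -/
lemma mem_of_col_le {m n : ℕ} {S : Submodule ℝ (Matrix (Fin m) (Fin n) ℝ)}
    {U : Submodule ℝ (Fin m → ℝ)} (hS : ∀ u ∈ U, ∀ v, vecMulVec u v ∈ S)
    {M : Matrix (Fin m) (Fin n) ℝ} (hM : ∀ x, M *ᵥ x ∈ U) : M ∈ S := by
  have : M = ∑ c, vecMulVec (M *ᵥ Pi.single c 1) (Pi.single c 1) := by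
    ext i j
    simp [Matrix.sum_apply, vecMulVec_apply, Pi.single_apply]
  rw [this]
  exact S.sum_mem fun c _ => hS _ (hM _) _

lemma mem_of_row_le {m n : ℕ} {S : Submodule ℝ (Matrix (Fin m) (Fin n) ℝ)}
    {V : Submodule ℝ (Fin n → ℝ)} (hS : ∀ u, ∀ v ∈ V, vecMulVec u v ∈ S)
    {M : Matrix (Fin m) (Fin n) ℝ} (hM : ∀ y, Mᵀ *ᵥ y ∈ V) : M ∈ S := by
  have : M = ∑ r, vecMulVec (Pi.single r 1) (Mᵀ *ᵥ Pi.single r 1) := by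
    ext i j
    simp [Matrix.sum_apply, vecMulVec_apply, Pi.single_apply]
  rw [this]
  exact S.sum_mem fun c _ => hS _ _ (hM _)

lemma mem_null {m n : ℕ} {M : Matrix (Fin m) (Fin n) ℝ} {x : Fin n → ℝ} :
    x ∈ null M ↔ M *ᵥ x = 0 := by
  rw [null, LinearMap.mem_ker, mulVecLin_apply]

/-- The kernel of `M ↦ X M Y` is generated by rank-one matrices. -/
lemma ker_sandwich_le {k l m n : ℕ} {X : Matrix (Fin k) (Fin l) ℝ}
    {Y : Matrix (Fin m) (Fin n) ℝ} {S : Submodule ℝ (Matrix (Fin l) (Fin m) ℝ)}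
    (h₁ : ∀ u ∈ null X, ∀ v, vecMulVec u v ∈ S) (h₂ : ∀ u, ∀ v ∈ null Yᵀ, vecMulVec u v ∈ S) :
    LinearMap.ker (sandwich X Y) ≤ S := by
  intro M hM
  rw [LinearMap.mem_ker, sandwich_apply] at hM
  obtain ⟨G, hG⟩ := exists_mul_mul_eq_self X
  -- The first summand has columns in `null X` because `X G X = X`; the second has rows in `null Yᵀ`
  -- because `X M Y = 0`.
  have e : M = (M - G * X * M) + G * X * M := by abel
  rw [e]
  refine S.add_mem (mem_of_col_le h₁ fun x => ?_) (mem_of_row_le h₂ fun y => ?_)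
  · rw [mem_null, mulVec_mulVec, Matrix.mul_sub, ← Matrix.mul_assoc, ← Matrix.mul_assoc, hG,
      sub_self, zero_mulVec]
  · rw [mem_null, mulVec_mulVec, ← transpose_mul, Matrix.mul_assoc, Matrix.mul_assoc,
      ← Matrix.mul_assoc X, hM, Matrix.mul_zero, transpose_zero, zero_mulVec]

/-! ### Subsequence matrices and the differential of `μ` -/

lemma diagOnes_self (m : ℕ) : diagOnes m m = 1 := by
  ext i j
  simp [diagOnes, Matrix.one_apply, Fin.ext_iff]

lemma subseq_self (θ : Weights L d) (i : ℕ) : subseq θ i i = 1 := by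
  cases i <;> simp [subseq, diagOnes_self]

lemma subseq_succ (θ : Weights L d) {i k : ℕ} (h : i ≤ k) :
    subseq θ i (k + 1) = factor θ k * subseq θ i k := by
  simp [subseq, show i ≠ k + 1 by omega]

lemma subseq_mul_subseq (θ : Weights L d) {i j k : ℕ} (hij : i ≤ j) (hjk : j ≤ k) :
    subseq θ j k * subseq θ i j = subseq θ i k := by
  induction k, hjk using Nat.le_induction with
  | base => rw [subseq_self, Matrix.one_mul]
  | succ k hjk ih =>
    rw [subseq_succ θ hjk, subseq_succ θ (hij.trans hjk), Matrix.mul_assoc, ih]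

lemma subseq_succ_left (θ : Weights L d) {i k : ℕ} (h : i + 1 ≤ k) :
    subseq θ i k = subseq θ (i + 1) k * factor θ i := by
  rw [← subseq_mul_subseq θ (Nat.le_succ i) h, subseq_succ θ le_rfl, subseq_self, Matrix.mul_one]

lemma factor_eq (θ : Weights L d) (p : Fin L) : factor θ p = θ p := by
  simp [factor]

lemma factor_of_lt (θ : Weights L d) {p : ℕ} (hp : p < L) : factor θ p = θ ⟨p, hp⟩ := by
  simp [factor, hp]

lemma subseq_eq_zero (θ : Weights L d) {i : ℕ} (hi : i ≤ L) : subseq θ i (L + 1) = 0 := by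
  rw [subseq_succ θ hi, factor, dif_neg (lt_irrefl L), Matrix.zero_mul]

/-- The differential of `μ` at `θ`. -/
def dmuForm (θ : Weights L d) : Weights L d →ₗ[ℝ] Matrix (Fin (d L)) (Fin (d 0)) ℝ :=
  ∑ p : Fin L, sandwich (subseq θ (p + 1) L) (subseq θ 0 p) ∘ₗ LinearMap.proj p

lemma dmuForm_apply (θ Δ : Weights L d) :
    dmuForm θ Δ = ∑ p : Fin L, sandwich (subseq θ (p + 1) L) (subseq θ 0 p) (Δ p) := by
  simp [dmuForm]

lemma dmuForm_single (θ : Weights L d) (p : Fin L)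
    (M : Matrix (Fin (d (p + 1))) (Fin (d p)) ℝ) :
    dmuForm θ (Pi.single p M) = sandwich (subseq θ (p + 1) L) (subseq θ 0 p) M := by
  rw [dmuForm_apply, Finset.sum_eq_single p]
  · rw [Pi.single_eq_same]
  · intro q _ hq
    rw [Pi.single_eq_of_ne hq, map_zero]
  · simp

/-- Matrix multiplication as a continuous bilinear map. -/
def mulCLM (l m n : ℕ) : Matrix (Fin l) (Fin m) ℝ →L[ℝ] Matrix (Fin m) (Fin n) ℝ →L[ℝ]
    Matrix (Fin l) (Fin n) ℝ :=
  LinearMap.toContinuousBilinearMap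
    (LinearMap.mk₂ ℝ (fun (M : Matrix (Fin l) (Fin m) ℝ) (N : Matrix (Fin m) (Fin n) ℝ) => M * N)
      Matrix.add_mul (fun c M N => Matrix.smul_mul c M N) Matrix.mul_add
      (fun c M N => Matrix.mul_smul M c N))

lemma mulCLM_apply {l m n : ℕ} (M : Matrix (Fin l) (Fin m) ℝ) (N : Matrix (Fin m) (Fin n) ℝ) :
    mulCLM l m n M N = M * N := rfl

/-- The product rule, by induction on the number of factors. The guard `p < k` keeps the factors
that occur in `W_{k∼0}`. -/
lemma hasFDerivAt_subseq (θ : Weights L d) (k : ℕ) (hk : k ≤ L) :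
    ∃ D : Weights L d →L[ℝ] Matrix (Fin (d k)) (Fin (d 0)) ℝ,
      HasFDerivAt (fun θ' : Weights L d => subseq θ' 0 k) D θ ∧
      ∀ Δ : Weights L d, D Δ = ∑ p : Fin L, if (p : ℕ) < k then
        subseq θ (p + 1) k * Δ p * subseq θ 0 p else 0 := by
  induction k with
  | zero =>
    refine ⟨0, ?_, fun Δ => by simp⟩
    have : (fun θ' : Weights L d => subseq θ' 0 0) = fun _ => 1 :=
      funext fun θ' => subseq_self θ' 0
    rw [this]
    exact hasFDerivAt_const _ _
  | succ k ih =>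
    obtain ⟨D, hD, hD'⟩ := ih (by omega)
    have hk' : k < L := hk
    have hf : HasFDerivAt (fun θ' : Weights L d => θ' ⟨k, hk'⟩)
      (ContinuousLinearMap.proj (R := ℝ)
        (φ := fun q : Fin L => Matrix (Fin (d (q + 1))) (Fin (d q)) ℝ) ⟨k, hk'⟩) θ :=
      hasFDerivAt_apply _ _
    have h := (mulCLM _ _ _).hasFDerivAt_of_bilinear hf hD
    have e : (fun θ' : Weights L d => subseq θ' 0 (k + 1)) =
        fun θ' => mulCLM _ _ _ (θ' ⟨k, hk'⟩) (subseq θ' 0 k) := by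
      funext θ'
      rw [subseq_succ θ' (Nat.zero_le k), factor_of_lt θ' hk', mulCLM_apply]
    rw [e]
    refine ⟨_, h, fun Δ => ?_⟩
    have e1 : ((mulCLM _ _ _).precompR (Weights L d) (θ ⟨k, hk'⟩) D +
        (mulCLM _ _ _).precompL (Weights L d) (ContinuousLinearMap.proj (R := ℝ)
        (φ := fun q : Fin L => Matrix (Fin (d (q + 1))) (Fin (d q)) ℝ) ⟨k, hk'⟩)
        (subseq θ 0 k)) Δ = θ ⟨k, hk'⟩ * D Δ + Δ ⟨k, hk'⟩ * subseq θ 0 k := rfl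
    refine e1.trans ?_
    rw [hD', Matrix.mul_sum]
    have e2 : Δ ⟨k, hk'⟩ * subseq θ 0 k = ∑ p : Fin L, if p = ⟨k, hk'⟩ then
        subseq θ (p + 1) (k + 1) * Δ p * subseq θ 0 p else 0 := by
      rw [Finset.sum_eq_single ⟨k, hk'⟩]
      · simp [subseq_self]
      · intro q _ hq; rw [if_neg hq]
      · simp
    rw [e2]
    rw [← Finset.sum_add_distrib]
    refine Finset.sum_congr rfl fun p _ => ?_
    -- Blocks `p < k` come from differentiating `W_{k∼0}`, block `p = k` from the new factor, and
    -- later blocks contribute nothing.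
    rcases lt_trichotomy (p : ℕ) k with hp | hp | hp
    · rw [if_pos hp, if_neg (by rw [Fin.ext_iff]; exact hp.ne), if_pos (by omega), add_zero,
        subseq_succ θ hp, factor_of_lt θ hk', Matrix.mul_assoc, Matrix.mul_assoc,
        Matrix.mul_assoc]
    · rw [if_neg (by omega), if_pos (Fin.ext hp), if_pos (by omega), Matrix.mul_zero, zero_add]
    · rw [if_neg (by omega), if_neg (by rw [Fin.ext_iff]; exact hp.ne'), if_neg (by omega),
        Matrix.mul_zero, zero_add]

lemma hasFDerivAt_mu (θ : Weights L d) :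
    HasFDerivAt (mu (L := L) (d := d)) (LinearMap.toContinuousLinearMap (dmuForm θ)) θ := by
  obtain ⟨D, hD, hD'⟩ := hasFDerivAt_subseq θ L le_rfl
  have : D = LinearMap.toContinuousLinearMap (dmuForm θ) := by
    ext1 Δ
    rw [hD', LinearMap.coe_toContinuousLinearMap', dmuForm_apply]
    refine Finset.sum_congr rfl fun p _ => ?_
    rw [if_pos p.2, sandwich_apply]
  rw [← this]
  exact hD

lemma nullDmu_eq (θ : Weights L d) : nullDmu θ = LinearMap.ker (dmuForm θ) := by
  rw [nullDmu, (hasFDerivAt_mu θ).fderiv]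
  rfl

/-! ### Dimension of the nullspace of the differential -/

/-- The image under `dμ(θ)` of the displacements of `W_{p+1}`. -/
def moveRange (θ : Weights L d) (p : ℕ) : Submodule ℝ (Matrix (Fin (d L)) (Fin (d 0)) ℝ) :=
  LinearMap.range (sandwich (subseq θ (p + 1) L) (subseq θ 0 p))

/-- The matrices `W_{L∼j} H W_{j∼0}`. -/
def layerRange (θ : Weights L d) (j : ℕ) : Submodule ℝ (Matrix (Fin (d L)) (Fin (d 0)) ℝ) :=
  LinearMap.range (sandwich (subseq θ j L) (subseq θ 0 j))

/-- The image under `dμ(θ)` of the displacements of `W_1, …, W_m`. -/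
def partialRange (θ : Weights L d) (m : ℕ) : Submodule ℝ (Matrix (Fin (d L)) (Fin (d 0)) ℝ) :=
  ⨆ p < m, moveRange θ p

lemma moveRange_le_partialRange (θ : Weights L d) {p m : ℕ} (h : p < m) :
    moveRange θ p ≤ partialRange θ m :=
  le_biSup (moveRange θ) h

/-- For `p < m` the matrix `W_{L∼p+1}` starts with `W_{L∼m}` on the left, so elements of
`partialRange θ m` have columns in `col W_{L∼m}`. Elements of `moveRange θ m` have rows in `row
W_{m∼0}`, and `mem_range_sandwich` combines the two. -/
lemma partialRange_inf_moveRange_le (θ : Weights L d) {m : ℕ} (hm : m < L) :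
    partialRange θ m ⊓ moveRange θ m ≤ layerRange θ m := by
  rintro E ⟨h₁, M, rfl⟩
  refine mem_range_sandwich ?_ ⟨_, rfl⟩
  -- The identity on the right makes `G` the space of matrices with columns in `col W_{L∼m}`.
  let G : Submodule ℝ (Matrix (Fin (d L)) (Fin (d 0)) ℝ) :=
    LinearMap.range (sandwich (subseq θ m L) (1 : Matrix (Fin (d 0)) (Fin (d 0)) ℝ))
  have hG : partialRange θ m ≤ G := by
    refine iSup₂_le fun p hp => ?_
    rintro _ ⟨N, rfl⟩
    refine ⟨subseq θ (p + 1) m * N * subseq θ 0 p, ?_⟩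
    rw [sandwich_apply, sandwich_apply, Matrix.mul_one, ← Matrix.mul_assoc, ← Matrix.mul_assoc,
      subseq_mul_subseq θ hp hm.le]
  obtain ⟨Z, hZ⟩ := hG h₁
  exact ⟨Z, by rw [← hZ, sandwich_apply, Matrix.mul_one]⟩

lemma layerRange_le_moveRange (θ : Weights L d) {m : ℕ} (hm : m < L) :
    layerRange θ m ≤ moveRange θ m := by
  rintro _ ⟨H, rfl⟩
  refine ⟨factor θ m * H, ?_⟩
  rw [sandwich_apply, sandwich_apply, ← Matrix.mul_assoc, ← subseq_succ_left θ hm]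

lemma layerRange_succ_le_moveRange (θ : Weights L d) (m : ℕ) :
    layerRange θ (m + 1) ≤ moveRange θ m := by
  rintro _ ⟨H, rfl⟩
  refine ⟨H * factor θ m, ?_⟩
  rw [sandwich_apply, sandwich_apply, subseq_succ θ (Nat.zero_le m), Matrix.mul_assoc,
    Matrix.mul_assoc, Matrix.mul_assoc]

/-- The index is `m + 1` because at `0` the partial range is zero while `layerRange θ 0` need not
be. This is why the last sum in `dFree` starts at `j = 1`. -/
lemma partialRange_inf_moveRange (θ : Weights L d) {m : ℕ} (hm : m + 1 < L) :
    partialRange θ (m + 1) ⊓ moveRange θ (m + 1) = layerRange θ (m + 1) :=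
  le_antisymm (partialRange_inf_moveRange_le θ hm)
    (le_inf ((layerRange_succ_le_moveRange θ m).trans (moveRange_le_partialRange θ m.lt_succ_self))
      (layerRange_le_moveRange θ hm))

/-- Inclusion–exclusion: adding `moveRange θ m` adds its dimension minus that of the intersection,
which is `layerRange θ m` for `m ≥ 1` and zero for `m = 0`. -/
lemma finrank_partialRange (θ : Weights L d) (m : ℕ) (hm : m ≤ L) :
    (Module.finrank ℝ (partialRange θ m) : ℤ) =
      (∑ p ∈ Finset.range m, ((subseq θ (p + 1) L).rank : ℤ) * (subseq θ 0 p).rank)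
        - ∑ j ∈ Finset.Ico 1 m, ((subseq θ j L).rank : ℤ) * (subseq θ 0 j).rank := by
  have hsucc : ∀ m, partialRange θ (m + 1) = partialRange θ m ⊔ moveRange θ m :=
    fun m => Nat.iSup_lt_succ (moveRange θ) m
  have h0 : partialRange θ 0 = ⊥ := by simp [partialRange]
  induction m with
  | zero => simp [h0]
  | succ m ih =>
    have ih := ih (by omega)
    have key := Submodule.finrank_sup_add_finrank_inf_eq (partialRange θ m) (moveRange θ m)
    rw [← hsucc] at key
    have hR : Module.finrank ℝ (moveRange θ m) =
        (subseq θ (m + 1) L).rank * (subseq θ 0 m).rank := finrank_range_sandwich _ _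
    rw [hR] at key
    rw [Finset.sum_range_succ]
    cases m with
    | zero =>
      rw [h0, bot_inf_eq, finrank_bot] at key
      simp only [Finset.range_zero, Finset.sum_empty, zero_add, Finset.Ico_self, sub_zero]
      exact_mod_cast by omega
    | succ m =>
      have hQ : Module.finrank ℝ (layerRange θ (m + 1)) =
        (subseq θ (m + 1) L).rank * (subseq θ 0 (m + 1)).rank := finrank_range_sandwich _ _
      rw [partialRange_inf_moveRange θ hm, hQ] at key
      rw [Finset.sum_Ico_succ_top (Nat.le_add_left 1 m)]
      zify at key
      linarith

lemma range_dmuForm (θ : Weights L d) : LinearMap.range (dmuForm θ) = partialRange θ L := by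
  apply le_antisymm
  · rintro _ ⟨Δ, rfl⟩
    rw [dmuForm_apply]
    exact Submodule.sum_mem _ fun p _ => moveRange_le_partialRange θ p.2 ⟨_, rfl⟩
  · refine iSup₂_le fun p hp => ?_
    rintro _ ⟨M, rfl⟩
    exact ⟨Pi.single (⟨p, hp⟩ : Fin L) M, dmuForm_single θ ⟨p, hp⟩ M⟩

lemma finrank_nullDmu (θ : Weights L d) :
    (Module.finrank ℝ (nullDmu θ) : ℤ) = dFree θ := by
  have h := LinearMap.finrank_range_add_finrank_ker (dmuForm θ)
  rw [range_dmuForm, ← nullDmu_eq] at h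
  have hd : Module.finrank ℝ (Weights L d) = ∑ p ∈ Finset.range L, d (p + 1) * d p := by
    rw [Module.finrank_pi_fintype, Finset.sum_range]
    refine Finset.sum_congr rfl fun p _ => ?_
    rw [Module.finrank_matrix]
    simp
  rw [hd] at h
  have hT := finrank_partialRange θ L le_rfl
  zify at h
  rw [dFree]
  linarith

/-! ### Generators of the nullspace of the differential -/

/-- Both blocks have the image `W_{L∼j} H W_{j∼0}`, with opposite signs. -/
lemma dmuForm_twoMatrixTangent (θ : Weights L d) (p : ℕ) (hp : p + 1 < L)
    (H : Matrix (Fin (d (p + 1))) (Fin (d (p + 1))) ℝ) :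
    dmuForm θ (twoMatrixTangent θ p hp H) = 0 := by
  have e : twoMatrixTangent θ p hp H = Pi.single ⟨p + 1, hp⟩ (factor θ (p + 1) * H) -
    Pi.single ⟨p, Nat.lt_of_succ_lt hp⟩ (H * factor θ p) := rfl
  rw [e, map_sub, dmuForm_single, dmuForm_single, sandwich_apply, sandwich_apply, sub_eq_zero,
    ← Matrix.mul_assoc, ← subseq_succ_left θ hp, subseq_succ θ (Nat.zero_le p), Matrix.mul_assoc,
    Matrix.mul_assoc, Matrix.mul_assoc]

/-- The nullspace of `dμ(θ)` is generated by one-matrix and two-matrix directions. -/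
lemma nullDmu_le (θ : Weights L d) (S : Submodule ℝ (Weights L d))
    (h₁ : ∀ p : Fin L, ∀ M ∈ LinearMap.ker (sandwich (subseq θ (p + 1) L) (subseq θ 0 p)),
      Pi.single p M ∈ S)
    (h₂ : ∀ (p : ℕ) (hp : p + 1 < L) (H : Matrix (Fin (d (p + 1))) (Fin (d (p + 1))) ℝ),
      twoMatrixTangent θ p hp H ∈ S) : nullDmu θ ≤ S := by
  -- Induction on the number `m` of initial blocks that may be nonzero; each step clears the last
  -- one.
  suffices h : ∀ m ≤ L, ∀ Δ : Weights L d, (∀ p : Fin L, m ≤ p → Δ p = 0) → dmuForm θ Δ = 0 →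
      Δ ∈ S by
    intro Δ hΔ
    rw [nullDmu_eq] at hΔ
    exact h L le_rfl Δ (fun p hp => absurd p.2 (by omega)) hΔ
  intro m
  induction m with
  | zero =>
    intro _ Δ hΔ _
    rw [show Δ = 0 from funext fun p => hΔ p (Nat.zero_le _)]
    exact S.zero_mem
  | succ m ih =>
    intro hm Δ hΔ hnull
    have hm' : m < L := hm
    let q : Fin L := ⟨m, hm'⟩
    -- As `dμ(θ)(Δ) = 0`, the image of the last block is minus the sum of the images of the earlier
    -- ones.
    have hE : sandwich (subseq θ (m + 1) L) (subseq θ 0 m) (Δ q) ∈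
        partialRange θ m ⊓ moveRange θ m := by
      refine ⟨?_, _, rfl⟩
      rw [dmuForm_apply, ← Finset.add_sum_erase _ _ (Finset.mem_univ q)] at hnull
      rw [eq_neg_of_add_eq_zero_left hnull]
      refine Submodule.neg_mem _ (Submodule.sum_mem _ fun p hp => ?_)
      rcases lt_or_ge (p : ℕ) m with hpm | hpm
      · exact moveRange_le_partialRange θ hpm ⟨_, rfl⟩
      · have hne : (p : ℕ) ≠ m := fun h => Finset.ne_of_mem_erase hp (Fin.ext h)
        rw [hΔ p (by omega), map_zero]
        exact Submodule.zero_mem _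
    cases m with
    | zero =>
      have hE0 : sandwich (subseq θ (0 + 1) L) (subseq θ 0 0) (Δ q) = 0 := by
        simpa [partialRange] using hE.1
      have e : Δ = Pi.single q (Δ q) := by
        funext p
        by_cases hp : p = q
        · subst hp; rw [Pi.single_eq_same]
        · rw [Pi.single_eq_of_ne hp]
          exact hΔ p (by have : (p : ℕ) ≠ 0 := fun h => hp (Fin.ext h)
                         omega)
      rw [e]
      exact h₁ q _ hE0
    | succ m =>
      obtain ⟨H, hH⟩ := partialRange_inf_moveRange_le θ hm' hE
      have hker : Δ q - factor θ (m + 1) * H ∈ LinearMap.ker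
          (sandwich (subseq θ (q + 1) L) (subseq θ 0 q)) := by
        rw [LinearMap.mem_ker, map_sub, sub_eq_zero]
        refine hH.symm.trans ?_
        rw [sandwich_apply, sandwich_apply, ← Matrix.mul_assoc, ← subseq_succ_left θ hm']
      -- The two subtracted terms together have block `Δ q` at `q`, so the remainder vanishes there.
      -- The two-matrix tangent otherwise changes only the block just before `q`.
      have hsplit : Δ = (Δ - Pi.single q (Δ q - factor θ (m + 1) * H) -
          twoMatrixTangent θ m hm' H) + Pi.single q (Δ q - factor θ (m + 1) * H) +
          twoMatrixTangent θ m hm' H := by abel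
      rw [hsplit]
      refine S.add_mem (S.add_mem (ih (by omega) _ (fun p hp => ?_) ?_) (h₁ q _ hker)) (h₂ _ _ _)
      · have e : twoMatrixTangent θ m hm' H p =
          (Pi.single q (factor θ (m + 1) * H) : Weights L d) p -
          (Pi.single ⟨m, Nat.lt_of_succ_lt hm'⟩ (H * factor θ m) : Weights L d) p := rfl
        have hp2 : p ≠ ⟨m, Nat.lt_of_succ_lt hm'⟩ := by
          rintro rfl
          exact absurd hp (by simp)
        rw [Pi.sub_apply, Pi.sub_apply, e, Pi.single_eq_of_ne hp2]
        by_cases hpq : p = q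
        · subst hpq
          rw [Pi.single_eq_same, Pi.single_eq_same]
          abel
        · rw [Pi.single_eq_of_ne hpq, Pi.single_eq_of_ne hpq, hΔ p ?_]
          · simp
          · have : (p : ℕ) ≠ m + 1 := fun h => hpq (Fin.ext h)
            omega
      · rw [map_sub, map_sub, hnull, dmuForm_single, LinearMap.mem_ker.1 hker,
          dmuForm_twoMatrixTangent]
        simp

/-! ### Paths on the fiber -/

/-- `μ ∘ γ` is constant on `[0, ε]`, and one-sided derivatives at `0` are unique; the chain rule
does the rest. -/
lemma directions_subset_nullDmu {n : WithTop ℕ∞} {W : Matrix (Fin (d L)) (Fin (d 0)) ℝ}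
    {θ Δ : Weights L d} (h : Δ ∈ directions n W θ) : Δ ∈ nullDmu θ := by
  obtain ⟨ε, γ, h⟩ := h
  have h0 : (0 : ℝ) ∈ Icc 0 ε := ⟨le_rfl, h.pos.le⟩
  have hμ : HasFDerivAt (mu (L := L) (d := d)) (LinearMap.toContinuousLinearMap (dmuForm θ))
      (γ 0) := by rw [h.start]; exact hasFDerivAt_mu θ
  have h1 : HasDerivWithinAt (mu ∘ γ) (dmuForm θ Δ) (Icc 0 ε) 0 :=
    hμ.comp_hasDerivWithinAt 0 h.direction
  have h2 : HasDerivWithinAt (mu ∘ γ) 0 (Icc 0 ε) 0 :=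
    (hasDerivWithinAt_const (0 : ℝ) (Icc 0 ε) W).congr (fun t ht => h.mem_fiber t ht)
      (h.mem_fiber 0 h0)
  rw [nullDmu_eq, LinearMap.mem_ker]
  exact (uniqueDiffOn_Icc h.pos 0 h0).eq_deriv _ h1 h2

/-! ### Values of `μ` under one-matrix and two-matrix moves -/

lemma factor_add (θ η : Weights L d) (k : ℕ) : factor (θ + η) k = factor θ k + factor η k := by
  by_cases h : k < L
  · simp [factor, h]
  · simp [factor, h]

lemma factor_single_of_ne (p : Fin L) (N : Matrix (Fin (d (p + 1))) (Fin (d p)) ℝ) {k : ℕ}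
    (h : k ≠ p) : factor (Pi.single p N : Weights L d) k = 0 := by
  by_cases hk : k < L
  · rw [factor_of_lt _ hk, Pi.single_eq_of_ne]
    rintro rfl
    exact h rfl
  · simp [factor, hk]

lemma subseq_congr {θ η : Weights L d} {i k : ℕ} (h : ∀ q, i ≤ q → q < k → factor θ q = factor η q)
    (hik : i ≤ k) : subseq θ i k = subseq η i k := by
  induction k, hik using Nat.le_induction with
  | base => rw [subseq_self, subseq_self]
  | succ k hk ih =>
    rw [subseq_succ θ hk, subseq_succ η hk, h k hk k.lt_succ_self,
      ih fun q hq hqk => h q hq (hqk.trans k.lt_succ_self)]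

/-- `μ` is affine in each factor, so a null vector with a single nonzero block has no higher-order
terms and gives a whole line on the fiber. -/
lemma mu_add_single (θ : Weights L d) (p : Fin L) (N : Matrix (Fin (d (p + 1))) (Fin (d p)) ℝ) :
    mu (θ + Pi.single p N) = mu θ + sandwich (subseq θ (p + 1) L) (subseq θ 0 p) N := by
  obtain ⟨η, hη⟩ : ∃ η : Weights L d, η = θ + Pi.single p N := ⟨_, rfl⟩
  rw [← hη]
  have hne : ∀ q, q ≠ (p : ℕ) → factor η q = factor θ q := fun q hq => by
    rw [hη, factor_add, factor_single_of_ne p N hq, add_zero]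
  have e₁ : subseq η (p + 1) L = subseq θ (p + 1) L :=
    subseq_congr (fun q hq _ => hne q (by omega)) p.2
  have e₂ : subseq η 0 p = subseq θ 0 p :=
    subseq_congr (fun q _ hq => hne q (by omega)) (Nat.zero_le _)
  have e₃ : factor η p = factor θ p + N := by
    rw [hη, factor_add, factor_eq (Pi.single p N), Pi.single_eq_same]
  rw [mu, mu, ← subseq_mul_subseq η (Nat.zero_le (p + 1)) p.2,
    ← subseq_mul_subseq θ (Nat.zero_le (p + 1)) p.2, e₁, subseq_succ _ (Nat.zero_le _),
    subseq_succ _ (Nat.zero_le _), e₂, e₃, sandwich_apply, Matrix.add_mul, Matrix.mul_add,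
    Matrix.mul_assoc _ N]

lemma isOneMatrixDirection_single {W : Matrix (Fin (d L)) (Fin (d 0)) ℝ} {θ : Weights L d}
    (hθ : θ ∈ fiber W) (n : WithTop ℕ∞) {p : Fin L}
    {M : Matrix (Fin (d (p + 1))) (Fin (d p)) ℝ}
    (hM : M ∈ LinearMap.ker (sandwich (subseq θ (p + 1) L) (subseq θ 0 p)))
    (h0 : (Pi.single p M : Weights L d) ≠ 0) : IsOneMatrixDirection n W θ (Pi.single p M) := by
  have hfib : ∀ t : ℝ, θ + t • (Pi.single p M : Weights L d) ∈ fiber W := by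
    intro t
    rw [fiber, mem_ofPred_eq, ← Pi.single_smul, mu_add_single, map_smul, LinearMap.mem_ker.1 hM,
      smul_zero, add_zero]
    exact hθ
  have hder : ∀ t : ℝ, HasDerivAt (fun t : ℝ => θ + t • (Pi.single p M : Weights L d))
      (Pi.single p M) t := fun t =>
    (((hasDerivAt_id t).smul_const (Pi.single p M : Weights L d)).const_add θ).congr_deriv
      (one_smul ℝ _)
  refine ⟨⟨p, fun q hq => by rw [Pi.single_eq_of_ne hq]⟩, hfib, fun ε hε => ⟨hε, ?_, ?_, ?_, ?_, ?_⟩⟩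
  · exact (contDiff_const.add (contDiff_id.smul contDiff_const)).contDiffOn
  · exact fun t ht h => h0
      (((hder t).hasDerivWithinAt.derivWithin (uniqueDiffOn_Icc hε t ht)).symm.trans h)
  · exact fun t _ => hfib t
  · simp
  · exact (hder 0).hasDerivWithinAt

lemma mu_twoMatrixMove (θ : Weights L d) (p : ℕ) (hp : p + 1 < L)
    {M : Matrix (Fin (d (p + 1))) (Fin (d (p + 1))) ℝ} (hM : IsUnit M) :
    mu (twoMatrixMove θ p hp M) = mu θ := by
  have hpL : p < L := Nat.lt_of_succ_lt hp
  have f₀ : factor (twoMatrixMove θ p hp M) p = M⁻¹ * factor θ p := by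
    rw [factor_of_lt _ hpL, twoMatrixMove, Function.update_self]
  have f₁ : factor (twoMatrixMove θ p hp M) (p + 1) = factor θ (p + 1) * M := by
    rw [factor_of_lt _ hp, twoMatrixMove, Function.update_of_ne (by simp [Fin.ext_iff]),
      Function.update_self]
  have f₂ : ∀ q, q ≠ p → q ≠ p + 1 → factor (twoMatrixMove θ p hp M) q = factor θ q := by
    intro q h₁ h₂
    by_cases hq : q < L
    · rw [factor_of_lt _ hq, factor_of_lt _ hq, twoMatrixMove,
        Function.update_of_ne (by simpa [Fin.ext_iff] using h₁),
        Function.update_of_ne (by simpa [Fin.ext_iff] using h₂)]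
    · simp [factor, hq]
  have e₁ : subseq (twoMatrixMove θ p hp M) (p + 2) L = subseq θ (p + 2) L :=
    subseq_congr (fun q hq _ => f₂ q (by omega) (by omega)) hp
  have e₂ : subseq (twoMatrixMove θ p hp M) 0 p = subseq θ 0 p :=
    subseq_congr (fun q _ hq => f₂ q (by omega) (by omega)) (Nat.zero_le _)
  have hMM : M * M⁻¹ = 1 := Matrix.mul_nonsing_inv M ((Matrix.isUnit_iff_isUnit_det M).1 hM)
  rw [mu, mu, ← subseq_mul_subseq _ (Nat.zero_le (p + 2)) hp,
    ← subseq_mul_subseq θ (Nat.zero_le (p + 2)) hp, e₁, subseq_succ _ (Nat.zero_le _),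
    subseq_succ _ (Nat.zero_le _), subseq_succ _ (Nat.zero_le _), subseq_succ _ (Nat.zero_le _),
    e₂, f₀, f₁]
  congr 1
  rw [Matrix.mul_assoc, Matrix.mul_assoc, ← Matrix.mul_assoc M, hMM,
    Matrix.one_mul]

/-! ### Smoothness and derivative of matrix inverses along a curve -/

lemma contDiffAt_det {m : ℕ} {n : WithTop ℕ∞} {A : ℝ → Matrix (Fin m) (Fin m) ℝ} {t : ℝ}
    (hA : ∀ i j, ContDiffAt ℝ n (fun t => A t i j) t) :
    ContDiffAt ℝ n (fun t => (A t).det) t := by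
  simp only [Matrix.det_apply']
  exact ContDiffAt.sum fun σ _ => contDiffAt_const.mul (contDiffAt_prod fun i _ => hA _ _)

lemma contDiffAt_matrix {l m : ℕ} {n : WithTop ℕ∞} {A : ℝ → Matrix (Fin l) (Fin m) ℝ} {t : ℝ} :
    ContDiffAt ℝ n A t ↔ ∀ i j, ContDiffAt ℝ n (fun t => A t i j) t :=
  contDiffAt_pi.trans (forall_congr' fun _ => contDiffAt_pi)

/-- By Cramer's rule the entries of the inverse are quotients of determinants, which treats every
smoothness order at once, `ω` included. -/
lemma contDiffAt_inv_matrix {m : ℕ} {n : WithTop ℕ∞} {A : ℝ → Matrix (Fin m) (Fin m) ℝ} {t : ℝ}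
    (hA : ContDiffAt ℝ n A t) (hu : IsUnit (A t)) : ContDiffAt ℝ n (fun t => (A t)⁻¹) t := by
  rw [contDiffAt_matrix] at hA ⊢
  intro i j
  have e : (fun t => (A t)⁻¹ i j) =
      fun t => ((A t).det)⁻¹ * ((A t).updateRow j (Pi.single i 1)).det := by
    funext t
    rw [Matrix.inv_def, Matrix.smul_apply, Ring.inverse_eq_inv', adjugate_apply, smul_eq_mul]
  rw [e]
  refine ((contDiffAt_det hA).inv ((Matrix.isUnit_iff_isUnit_det _).1 hu).ne_zero).mul
    (contDiffAt_det fun a b => ?_)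
  by_cases h : a = j
  · subst h
    simp only [updateRow_self]
    exact contDiffAt_const
  · simp only [updateRow_ne h]
    exact hA a b

lemma contDiffAt_one_add_smul {m : ℕ} (n : WithTop ℕ∞) (H : Matrix (Fin m) (Fin m) ℝ) (t : ℝ) :
    ContDiffAt ℝ n (fun t : ℝ => (1 : Matrix (Fin m) (Fin m) ℝ) + t • H) t :=
  contDiffAt_const.add (contDiffAt_id.smul contDiffAt_const)

lemma eventually_isUnit_one_add_smul {m : ℕ} (H : Matrix (Fin m) (Fin m) ℝ) :
    ∀ᶠ t : ℝ in nhds 0, IsUnit (1 + t • H) := by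
  have hc : ContinuousAt (fun t : ℝ => (1 + t • H).det) 0 :=
    (contDiffAt_det (contDiffAt_matrix.1 (contDiffAt_one_add_smul 0 H 0))).continuousAt
  have h0 : ((1 : Matrix (Fin m) (Fin m) ℝ) + (0 : ℝ) • H).det ≠ 0 := by simp
  filter_upwards [hc.eventually_ne h0] with t ht
  exact (Matrix.isUnit_iff_isUnit_det _).2 (isUnit_iff_ne_zero.2 ht)

lemma hasDerivAt_inv_one_add_smul {m : ℕ} (H : Matrix (Fin m) (Fin m) ℝ) :
    HasDerivAt (fun t : ℝ => (1 + t • H)⁻¹) (-H) 0 := by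
  have hd : HasDerivAt (fun t : ℝ => (1 + t • H)⁻¹) _ 0 :=
    ((contDiffAt_inv_matrix (n := 1) (contDiffAt_one_add_smul 1 H 0) (by simp)).differentiableAt
      one_ne_zero).hasDerivAt
  -- Differentiating `(1 + tH)⁻¹ = 1 - t H (1 + tH)⁻¹` at `0` yields `-H`: the still unknown
  -- derivative of the inverse is multiplied by `t = 0`.
  have h1 := (hasDerivAt_id (0 : ℝ)).smul ((mulCLM m m m H).hasFDerivAt.comp_hasDerivAt 0 hd)
  have h2 := h1.const_sub (1 : Matrix (Fin m) (Fin m) ℝ)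
  have h3 : HasDerivAt (fun t : ℝ => (1 + t • H)⁻¹) _ 0 := h2.congr_of_eventuallyEq (by
    filter_upwards [eventually_isUnit_one_add_smul H] with t ht
    have hinv := Matrix.mul_nonsing_inv _ ((Matrix.isUnit_iff_isUnit_det _).1 ht)
    change (1 + t • H)⁻¹ = 1 - t • (H * (1 + t • H)⁻¹)
    rw [eq_sub_iff_add_eq]
    rw [Matrix.add_mul, Matrix.one_mul, Matrix.smul_mul] at hinv
    exact hinv)
  convert h3 using 1
  simp [mulCLM_apply]

/-- Two-matrix tangent directions are directions of two-matrix paths. -/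
lemma isTwoMatrixDirection_tangent {W : Matrix (Fin (d L)) (Fin (d 0)) ℝ} {θ : Weights L d}
    (hθ : θ ∈ fiber W) (n : WithTop ℕ∞) {p : ℕ} {hp : p + 1 < L}
    {H : Matrix (Fin (d (p + 1))) (Fin (d (p + 1))) ℝ} (h0 : twoMatrixTangent θ p hp H ≠ 0) :
    IsTwoMatrixDirection n W θ (twoMatrixTangent θ p hp H) := by
  set γ : ℝ → Weights L d := fun t => twoMatrixMove θ p hp (1 + t • H) with hγ
  have hne : (⟨p + 1, hp⟩ : Fin L) ≠ ⟨p, Nat.lt_of_succ_lt hp⟩ := by simp [Fin.ext_iff]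
  have hγp : ∀ t, γ t ⟨p, Nat.lt_of_succ_lt hp⟩ = (1 + t • H)⁻¹ * factor θ p := fun t => by
    rw [hγ]; simp only [twoMatrixMove, Function.update_self]
  have hγp1 : ∀ t, γ t ⟨p + 1, hp⟩ = factor θ (p + 1) * (1 + t • H) := fun t => by
    rw [hγ]; simp only [twoMatrixMove, Function.update_of_ne hne, Function.update_self]
  have hγq : ∀ t, ∀ q : Fin L, q ≠ ⟨p, Nat.lt_of_succ_lt hp⟩ → q ≠ ⟨p + 1, hp⟩ → γ t q = θ q :=
    fun t q h₁ h₂ => by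
      rw [hγ]; simp only [twoMatrixMove, Function.update_of_ne h₁, Function.update_of_ne h₂]
  have hτ : ∀ q, twoMatrixTangent θ p hp H q =
      (Pi.single ⟨p + 1, hp⟩ (factor θ (p + 1) * H) : Weights L d) q -
      (Pi.single ⟨p, Nat.lt_of_succ_lt hp⟩ (H * factor θ p) : Weights L d) q := fun _ => rfl
  have hsmooth : ∀ (k : WithTop ℕ∞) (t : ℝ), IsUnit (1 + t • H) → ContDiffAt ℝ k γ t := by
    intro k t ht
    refine contDiffAt_pi.2 fun q => ?_
    by_cases h₁ : q = ⟨p, Nat.lt_of_succ_lt hp⟩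
    · subst h₁
      simp only [hγp]
      exact ((mulCLM _ _ _).flip (factor θ p)).contDiff.contDiffAt.comp t
        (contDiffAt_inv_matrix (contDiffAt_one_add_smul k H t) ht)
    by_cases h₂ : q = ⟨p + 1, hp⟩
    · subst h₂
      simp only [hγp1]
      exact (mulCLM _ _ _ (factor θ (p + 1))).contDiff.contDiffAt.comp t
        (contDiffAt_one_add_smul k H t)
    · simp only [hγq _ q h₁ h₂]
      exact contDiffAt_const
  have hder : HasDerivAt γ (twoMatrixTangent θ p hp H) 0 := by
    refine hasDerivAt_pi.2 fun q => ?_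
    rw [hτ]
    by_cases h₁ : q = ⟨p, Nat.lt_of_succ_lt hp⟩
    · subst h₁
      simp only [hγp]
      rw [Pi.single_eq_of_ne hne.symm, Pi.single_eq_same, zero_sub, ← Matrix.neg_mul]
      exact ((mulCLM _ _ _).flip (factor θ p)).hasFDerivAt.comp_hasDerivAt (0 : ℝ)
        (hasDerivAt_inv_one_add_smul H)
    by_cases h₂ : q = ⟨p + 1, hp⟩
    · subst h₂
      simp only [hγp1]
      rw [Pi.single_eq_of_ne hne, Pi.single_eq_same, sub_zero]
      have hl : HasDerivAt (fun t : ℝ => (1 : Matrix _ _ ℝ) + t • H) H 0 :=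
        (((hasDerivAt_id (0 : ℝ)).smul_const H).const_add 1).congr_deriv (one_smul ℝ H)
      exact (mulCLM _ _ _ (factor θ (p + 1))).hasFDerivAt.comp_hasDerivAt (0 : ℝ) hl
    · simp only [hγq _ q h₁ h₂]
      rw [Pi.single_eq_of_ne h₁, Pi.single_eq_of_ne h₂, sub_zero]
      exact hasDerivAt_const _ _
  have hu0 : IsUnit ((1 : Matrix (Fin (d (p + 1))) (Fin (d (p + 1))) ℝ) + (0 : ℝ) • H) := by simp
  -- The velocity is nonzero at `0` and continuous there, since `γ` is of class `C^2` at `0`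
  -- whatever `n` is; so it is nonzero nearby.
  have hreg : ∀ᶠ t in nhds (0 : ℝ), deriv γ t ≠ 0 := by
    have hc : ContinuousAt (deriv γ) 0 :=
      ((hsmooth 2 0 hu0).derivWithin (m := 1) (by norm_num)).continuousAt
    exact hc.eventually_ne fun h => h0 (hder.deriv.symm.trans h)
  -- The path is run up to `δ / 2`, so that the closed interval lies in the open ball of radius `δ`.
  obtain ⟨δ, hδ, hball⟩ := Metric.eventually_nhds_iff.1
    ((eventually_isUnit_one_add_smul H).and hreg)
  have hε : (0 : ℝ) < δ / 2 := half_pos hδ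
  have hIcc : ∀ t ∈ Icc 0 (δ / 2), IsUnit (1 + t • H) ∧ deriv γ t ≠ 0 := fun t ht =>
    hball (by rw [Real.dist_eq, sub_zero, abs_of_nonneg ht.1]; linarith [ht.2])
  refine ⟨p, hp, H, δ / 2, fun t ht => (hIcc t ht).1, hε, ?_, ?_, ?_, ?_, ?_⟩
  · exact fun t ht => (hsmooth n t (hIcc t ht).1).contDiffWithinAt
  · exact fun t ht h => (hIcc t ht).2
      ((((hsmooth 1 t (hIcc t ht).1).differentiableAt one_ne_zero).derivWithin
        (uniqueDiffOn_Icc hε t ht)).symm.trans h)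
  · intro t ht
    rw [fiber, mem_ofPred_eq, mu_twoMatrixMove θ p hp (hIcc t ht).1]
    exact hθ
  · funext q
    by_cases h₁ : q = ⟨p, Nat.lt_of_succ_lt hp⟩
    · subst h₁
      refine (hγp 0).trans ?_
      simp [factor_of_lt θ (Nat.lt_of_succ_lt hp)]
    by_cases h₂ : q = ⟨p + 1, hp⟩
    · subst h₂
      refine (hγp1 0).trans ?_
      simp [factor_of_lt θ hp]
    · exact hγq 0 q h₁ h₂
  · exact hder.hasDerivWithinAt

/-! ### The span of the directions and its dimension -/

lemma IsOneMatrixDirection.mem_directions {n : WithTop ℕ∞} {W : Matrix (Fin (d L)) (Fin (d 0)) ℝ}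
    {θ Δ : Weights L d} (h : IsOneMatrixDirection n W θ Δ) : Δ ∈ directions n W θ :=
  ⟨1, _, h.2.2 1 one_pos⟩

lemma IsTwoMatrixDirection.mem_directions {n : WithTop ℕ∞} {W : Matrix (Fin (d L)) (Fin (d 0)) ℝ}
    {θ Δ : Weights L d} (h : IsTwoMatrixDirection n W θ Δ) : Δ ∈ directions n W θ := by
  obtain ⟨p, hp, H, ε, -, h⟩ := h
  exact ⟨ε, _, h⟩

/-- The directions of smooth paths on the fiber span the nullspace of `dμ(θ)`. -/
lemma span_directions {W : Matrix (Fin (d L)) (Fin (d 0)) ℝ} {θ : Weights L d}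
    (hθ : θ ∈ fiber W) (n : WithTop ℕ∞) :
    Submodule.span ℝ (directions n W θ) = nullDmu θ := by
  refine le_antisymm (Submodule.span_le.2 fun Δ => directions_subset_nullDmu)
    (nullDmu_le θ _ (fun p M hM => ?_) fun p hp H => ?_)
  -- Paths have nonvanishing velocity, so zero is not a direction and is treated apart.
  · by_cases h0 : (Pi.single p M : Weights L d) = 0
    · rw [h0]; exact Submodule.zero_mem _
    · exact Submodule.subset_span (isOneMatrixDirection_single hθ n hM h0).mem_directions
  · by_cases h0 : twoMatrixTangent θ p hp H = 0
    · rw [h0]; exact Submodule.zero_mem _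
    · exact Submodule.subset_span (isTwoMatrixDirection_tangent hθ n h0).mem_directions

/-- The maximum number of linearly independent vectors in a spanning set is the dimension. -/
lemma isGreatest_card_linearIndepOn {V : Type*} [AddCommGroup V] [Module ℝ V]
    [FiniteDimensional ℝ V] (D : Set V) :
    IsGreatest {m : ℤ | ∃ s : Finset V, (s.card : ℤ) = m ∧ (s : Set V) ⊆ D ∧
      LinearIndepOn ℝ id (s : Set V)} (Module.finrank ℝ (Submodule.span ℝ D)) := by
  constructor
  · obtain ⟨b, hbD, hspan, hb⟩ := exists_linearIndependent ℝ D
    have hfin : b.Finite := hb.setFinite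
    refine ⟨hfin.toFinset, ?_, by simpa using hbD, ?_⟩
    · have h : LinearIndepOn ℝ id (hfin.toFinset : Set V) := by
        rw [hfin.coe_toFinset]
        exact hb
      have h' := finrank_span_finset_eq_card (R := ℝ) h
      rw [hfin.coe_toFinset, hspan] at h'
      rw [h']
    · rw [hfin.coe_toFinset]
      exact hb
  · rintro _ ⟨s, rfl, hs, hli⟩
    have h := finrank_span_finset_eq_card (R := ℝ) (s := s) hli
    rw [← h]
    exact_mod_cast Submodule.finrank_mono (Submodule.span_mono hs)

/-! ### Prebases generate the layer spaces -/

/-- Unrolling `A_{kji} = a_{kji} + A_{k,j,i-1} + A_{k-1,j,i}` ends at `null W_{j∼j} = 0` or at `col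
W_{j∼-1} = 0`. Because of the shifted indices, `flowA θ K j I` is `A_{K-1,j,I-1}`, whence the strict
bounds in `hS`. -/
lemma flowA_le {θ : Weights L d} {a b : ℕ → (j : ℕ) → ℕ → Submodule ℝ (Fin (d j) → ℝ)}
    (hab : IsPrebasisChoice θ a b) {j : ℕ} {S : Submodule ℝ (Fin (d j) → ℝ)} (K I : ℕ)
    (hj : j ≤ K) (hK : K ≤ L + 1) (hI : I ≤ j + 1)
    (hS : ∀ k i, j ≤ k → k < K → i < I → a k j i ≤ S) : flowA θ K j I ≤ S := by
  induction K, hj using Nat.le_induction generalizing I with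
  | base =>
    rintro x ⟨hx, -⟩
    rw [subseq_self] at hx
    rw [show x = 0 by simpa using mem_null.1 hx]
    exact S.zero_mem
  | succ K hjK ihK =>
    induction I with
    | zero => exact inf_le_right.trans bot_le
    | succ I ihI =>
      rw [← (hab K j I (by omega) hjK (by omega)).1.1]
      exact sup_le (hS K I hjK K.lt_succ_self I.lt_succ_self) (sup_le
        (ihI (by omega) fun k i h₁ h₂ h₃ => hS k i h₁ h₂ (by omega))
        (ihK (I + 1) (by omega) hI fun k i h₁ h₂ h₃ => hS k i h₁ (by omega) h₃))

/-- Here the recursion raises `k` and `i`, so the induction runs on the distances `u` and `v` to the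
ends `K = L + 1`, where `W_{L+1∼j} = 0`, and `I = j + 1`, where `null W_{j∼j}ᵀ = 0`. -/
lemma flowB_le {θ : Weights L d} {a b : ℕ → (j : ℕ) → ℕ → Submodule ℝ (Fin (d j) → ℝ)}
    (hab : IsPrebasisChoice θ a b) {j : ℕ} {S : Submodule ℝ (Fin (d j) → ℝ)} (K I u v : ℕ)
    (hj : j ≤ K) (hjL : j ≤ L) (hK : K + u = L + 1) (hI : I + v = j + 1)
    (hS : ∀ k i, K ≤ k → k ≤ L → I ≤ i → i ≤ j → b k j i ≤ S) : flowB θ K j I ≤ S := by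
  induction u generalizing K I v with
  | zero =>
    obtain rfl : K = L + 1 := by omega
    rintro x ⟨⟨y, rfl⟩, -⟩
    rw [subseq_eq_zero θ hjL]
    simp
  | succ u ihu =>
    induction v generalizing I with
    | zero =>
      obtain rfl : I = j + 1 := by omega
      rintro x ⟨-, hx⟩
      rw [leftNullPrev, subseq_self] at hx
      rw [show x = 0 by simpa using mem_null.1 hx]
      exact S.zero_mem
    | succ v ihv =>
      rw [← (hab K j I (by omega) hj (by omega)).2.1]
      exact sup_le (hS K I le_rfl (by omega) le_rfl (by omega)) (sup_le
        (ihv (I + 1) (by omega) fun k i h₁ h₂ h₃ h₄ => hS k i h₁ h₂ (by omega) h₄)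
        (ihu (K + 1) I (v + 1) (by omega) (by omega) hI
          fun k i h₁ h₂ h₃ h₄ => hS k i (by omega) h₂ h₃ h₄))

section Generation

variable {θ : Weights L d} {a b : ℕ → (j : ℕ) → ℕ → Submodule ℝ (Fin (d j) → ℝ)}

/-- `null W_{L∼j}` is the flow subspace `A_{L-1,j,j}`, because `col W_{j∼j}` is everything; only `k
< L` enters its recursion. -/
lemma null_le_of_prebasis (hab : IsPrebasisChoice θ a b) {j : ℕ} (hj : j ≤ L)
    {S : Submodule ℝ (Fin (d j) → ℝ)}
    (hS : ∀ k i, j ≤ k → k < L → i ≤ j → a k j i ≤ S) : null (subseq θ j L) ≤ S := by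
  refine le_trans (le_inf le_rfl ?_) (flowA_le hab L (j + 1) hj (by omega) le_rfl
    fun k i h₁ h₂ h₃ => hS k i h₁ h₂ (by omega))
  intro x _
  rw [colPrev, subseq_self]
  exact ⟨x, by simp⟩

/-- The whole space is `A_{L,j,j}`, by the convention `W_{L+1∼j} = 0`. -/
lemma top_le_of_prebasis_left (hab : IsPrebasisChoice θ a b) {j : ℕ} (hj : j ≤ L)
    {S : Submodule ℝ (Fin (d j) → ℝ)}
    (hS : ∀ k i, j ≤ k → k ≤ L → i ≤ j → a k j i ≤ S) : ⊤ ≤ S := by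
  refine le_trans (le_inf ?_ ?_) (flowA_le hab (L + 1) (j + 1) (by omega) le_rfl le_rfl
    fun k i h₁ h₂ h₃ => hS k i h₁ (by omega) (by omega))
  · intro x _
    rw [mem_null, subseq_eq_zero θ hj, zero_mulVec]
  · intro x _
    rw [colPrev, subseq_self]
    exact ⟨x, by simp⟩

/-- `null W_{j∼0}ᵀ` is `B_{j,j,1}`, because `row W_{j∼j}` is everything; only `i ≥ 1` enters its
recursion. -/
lemma leftNull_le_of_prebasis (hab : IsPrebasisChoice θ a b) {j : ℕ} (hj : j ≤ L)
    {S : Submodule ℝ (Fin (d j) → ℝ)}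
    (hS : ∀ k i, j ≤ k → k ≤ L → 0 < i → i ≤ j → b k j i ≤ S) : null (subseq θ 0 j)ᵀ ≤ S := by
  refine le_trans (le_inf ?_ le_rfl) (flowB_le hab j 1 (L + 1 - j) j le_rfl hj (by omega)
    (by omega) fun k i h₁ h₂ h₃ h₄ => hS k i h₁ h₂ h₃ h₄)
  intro x _
  rw [subseq_self]
  exact ⟨x, by simp⟩

lemma top_le_of_prebasis_right (hab : IsPrebasisChoice θ a b) {j : ℕ} (hj : j ≤ L)
    {S : Submodule ℝ (Fin (d j) → ℝ)}
    (hS : ∀ k i, j ≤ k → k ≤ L → i ≤ j → b k j i ≤ S) : ⊤ ≤ S := by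
  refine le_trans (le_inf ?_ le_rfl) (flowB_le hab j 0 (L + 1 - j) (j + 1) le_rfl hj (by omega)
    (by omega) fun k i h₁ h₂ h₃ h₄ => hS k i h₁ h₂ h₄)
  intro x _
  rw [subseq_self]
  exact ⟨x, by simp⟩

/-- `a_{kji}` lies in `null W_{k+1∼j}`, and `W_{L∼j}` factors through `W_{k+1∼j}` when `k < L`. -/
lemma prebasis_left_le_null (hab : IsPrebasisChoice θ a b) {k j i : ℕ} (hk : k < L) (hj : j ≤ k)
    (hi : i ≤ j) : a k j i ≤ null (subseq θ j L) := by
  intro x hx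
  have h : x ∈ flowA θ (k + 1) j (i + 1) := by
    rw [← (hab k j i hk.le hj hi).1.1]
    exact Submodule.mem_sup_left hx
  rw [mem_null, ← subseq_mul_subseq θ (show j ≤ k + 1 by omega) hk, ← mulVec_mulVec,
    mem_null.1 h.1, mulVec_zero]

lemma prebasis_right_le_leftNull (hab : IsPrebasisChoice θ a b) {k j i : ℕ} (hk : k ≤ L)
    (hj : j ≤ k) (hi : i ≤ j) (h0 : 0 < i) : b k j i ≤ null (subseq θ 0 j)ᵀ := by
  obtain ⟨i, rfl⟩ := Nat.exists_eq_succ_of_ne_zero h0.ne'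
  intro x hx
  have h : x ∈ flowB θ k j (i + 1) := by
    rw [← (hab k j (i + 1) hk hj hi).2.1]
    exact Submodule.mem_sup_left hx
  rw [mem_null, ← subseq_mul_subseq θ (Nat.zero_le i) (show i ≤ j by omega), transpose_mul,
    ← mulVec_mulVec, mem_null.1 h.2, mulVec_zero]

/-- The matrices in `a_{lji} ⊗ b_{k,j-1,h}` with `L > l` or `h > 0` do not change `μ`. -/
lemma tensor_le_ker_sandwich (hab : IsPrebasisChoice θ a b) {l k i h j p : ℕ}
    (hjl : j ≤ l) (hi : i ≤ j) (hk : k ≤ L) (hpk : p ≤ k) (hh : h ≤ p)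
    (hlh : l < L ∨ 0 < h) :
    tensor (a l j i) (b k p h) ≤ LinearMap.ker (sandwich (subseq θ j L) (subseq θ 0 p)) := by
  rintro M ⟨h₁, h₂⟩
  rw [LinearMap.mem_ker, sandwich_apply]
  rcases hlh with hlt | hpos
  · have : subseq θ j L * M = 0 := by
      refine Matrix.ext_of_mulVec_single fun c => ?_
      rw [← mulVec_mulVec, mem_null.1 (prebasis_left_le_null hab hlt hjl hi (h₁ _)),
        zero_mulVec]
    rw [this, Matrix.zero_mul]
  · have : (subseq θ 0 p)ᵀ * Mᵀ = 0 := by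
      refine Matrix.ext_of_mulVec_single fun c => ?_
      rw [← mulVec_mulVec, mem_null.1 (prebasis_right_le_leftNull hab hk hpk hh hpos (h₂ _)),
        zero_mulVec]
    rw [← transpose_mul, transpose_eq_zero] at this
    rw [Matrix.mul_assoc, this, Matrix.mul_zero]

lemma isOneMatrixDirection_of_mem_thetaOFiber {W : Matrix (Fin (d L)) (Fin (d 0)) ℝ}
    (hθ : θ ∈ fiber W) (n : WithTop ℕ∞) (hab : IsPrebasisChoice θ a b)
    {X : Submodule ℝ (Weights L d)} (hX : X ∈ thetaOFiber L a b) {Δ : Weights L d} (hΔ : Δ ∈ X)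
    (h0 : Δ ≠ 0) : IsOneMatrixDirection n W θ Δ := by
  obtain ⟨-, l, k, p, i, h, ⟨-, hjl, hi⟩, ⟨hk, hpk, hh⟩, hlh, rfl⟩ := hX
  obtain ⟨M, hM, rfl⟩ := hΔ
  exact isOneMatrixDirection_single hθ n
    (tensor_le_ker_sandwich hab hjl hi hk hpk hh hlh hM) h0

lemma isTwoMatrixDirection_of_mem_thetaTL0 {W : Matrix (Fin (d L)) (Fin (d 0)) ℝ}
    (hθ : θ ∈ fiber W) (n : WithTop ℕ∞)
    {X : Submodule ℝ (Weights L d)} (hX : X ∈ thetaTL0 θ a b) {Δ : Weights L d} (hΔ : Δ ∈ X)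
    (h0 : Δ ≠ 0) : IsTwoMatrixDirection n W θ Δ := by
  obtain ⟨-, k, p, hp, i, -, -, -, rfl⟩ := hX
  obtain ⟨H, -, rfl⟩ := hΔ
  exact isTwoMatrixDirection_tangent hθ n h0

lemma phi_le_sSup {l k : ℕ} {p : Fin L} {i h : ℕ}
    (h₁ : l ≤ L ∧ (p : ℕ) + 1 ≤ l ∧ i ≤ (p : ℕ) + 1)
    (h₂ : k ≤ L ∧ (p : ℕ) ≤ k ∧ h ≤ (p : ℕ)) (h₃ : l < L ∨ 0 < h) :
    phi a b l k p i h ≤ sSup (thetaFree θ a b) := by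
  by_cases h0 : phi a b l k p i h = ⊥
  · rw [h0]; exact bot_le
  · exact le_sSup (Or.inl ⟨h0, l, k, p, i, h, h₁, h₂, h₃, rfl⟩)

lemma tau_le_sSup {k p : ℕ} {hp : p + 1 < L} {i : ℕ} (h₁ : k ≤ L) (h₂ : p + 1 ≤ k)
    (h₃ : i ≤ p + 1) : tau θ a b L k p hp i 0 ≤ sSup (thetaFree θ a b) := by
  by_cases h0 : tau θ a b L k p hp i 0 = ⊥
  · rw [h0]; exact bot_le
  · exact le_sSup (Or.inr ⟨h0, k, p, hp, i, h₁, h₂, h₃, rfl⟩)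

/-- The kernel is generated by rank-one matrices `u vᵀ` with `u ∈ null W_{L∼j}` or `v ∈ null
W_{j-1∼0}ᵀ`. The first kind needs only `a_{lji}` with `l < L`, the second only `b_{k,j-1,h}` with `h
> 0`: precisely the alternative in `thetaOFiber`. -/
lemma single_mem_sSup_thetaFree (hab : IsPrebasisChoice θ a b) (p : Fin L)
    {M : Matrix (Fin (d (p + 1))) (Fin (d p)) ℝ}
    (hM : M ∈ LinearMap.ker (sandwich (subseq θ (p + 1) L) (subseq θ 0 p))) :
    (Pi.single p M : Weights L d) ∈ sSup (thetaFree θ a b) := by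
  let S := (sSup (thetaFree θ a b)).comap
    (LinearMap.single ℝ (fun q : Fin L => Matrix (Fin (d (q + 1))) (Fin (d q)) ℝ) p)
  have hS : ∀ {l k i h : ℕ}, l ≤ L ∧ (p : ℕ) + 1 ≤ l ∧ i ≤ (p : ℕ) + 1 →
      k ≤ L ∧ (p : ℕ) ≤ k ∧ h ≤ (p : ℕ) → (l < L ∨ 0 < h) →
      ∀ u ∈ a l (p + 1) i, ∀ v ∈ b k p h, vecMulVec u v ∈ S :=
    fun h₁ h₂ h₃ u hu v hv => phi_le_sSup h₁ h₂ h₃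
      (Submodule.mem_map_of_mem (vecMulVec_mem_tensor hu hv))
  refine ker_sandwich_le (S := S) (fun u hu v => ?_) (fun u v hv => ?_) hM
  -- Pulling `S` back along `u ↦ u vᵀ` and then along `v ↦ u vᵀ` lets each factor be restricted to
  -- prebasis subspaces separately.
  · refine null_le_of_prebasis hab p.2 (S := S.comap (vecMulVecLeft _ v))
      (fun l i h₁ h₂ h₃ u hu => ?_) hu
    exact top_le_of_prebasis_right hab p.2.le (S := S.comap (vecMulVecRight _ u))
      (fun k h h₄ h₅ h₆ v hv => hS ⟨h₂.le, h₁, h₃⟩ ⟨h₅, h₄, h₆⟩ (Or.inl h₂) u hu v hv)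
      (Submodule.mem_top (x := v))
  · refine top_le_of_prebasis_left hab p.2 (S := S.comap (vecMulVecLeft _ v))
      (fun l i h₁ h₂ h₃ u hu => ?_) (Submodule.mem_top (x := u))
    exact leftNull_le_of_prebasis hab p.2.le (S := S.comap (vecMulVecRight _ u))
      (fun k h h₄ h₅ h₀ h₆ v hv => hS ⟨h₂, h₁, h₃⟩ ⟨h₅, h₄, h₆⟩ (Or.inr h₀) u hu v hv) hv

lemma twoMatrixTangent_mem_sSup_thetaFree (hab : IsPrebasisChoice θ a b) (p : ℕ) (hp : p + 1 < L)
    (H : Matrix (Fin (d (p + 1))) (Fin (d (p + 1))) ℝ) :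
    twoMatrixTangent θ p hp H ∈ sSup (thetaFree θ a b) := by
  let S := (sSup (thetaFree θ a b)).comap (twoMatrixTangent θ p hp)
  have hS : ∀ l i, p + 1 ≤ l → l ≤ L → i ≤ p + 1 → ∀ k h, p + 1 ≤ k → k ≤ L → h ≤ p + 1 →
      ∀ u ∈ a l (p + 1) i, ∀ v ∈ b k (p + 1) h, vecMulVec u v ∈ S := by
    intro l i h₁ h₂ h₃ k h h₄ h₅ h₆ u hu v hv
    have huv := vecMulVec_mem_tensor hu hv
    -- If `l < L` or `h > 0`, then `W_{L∼j} H W_{j∼0} = 0`, so each of the two blocks is null by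
    -- itself and is covered by one-matrix subspaces. Only `l = L`, `h = 0` calls for a `τ`
    -- subspace.
    by_cases hlh : l < L ∨ 0 < h
    · have h0 := LinearMap.mem_ker.1 (tensor_le_ker_sandwich hab h₁ h₃ h₅ h₄ h₆ hlh huv)
      rw [sandwich_apply] at h0
      refine Submodule.sub_mem _ (single_mem_sSup_thetaFree hab ⟨p + 1, hp⟩ ?_)
        (single_mem_sSup_thetaFree hab ⟨p, Nat.lt_of_succ_lt hp⟩ ?_)
      · rw [LinearMap.mem_ker, sandwich_apply]
        refine Eq.trans ?_ h0
        rw [← Matrix.mul_assoc, ← subseq_succ_left θ hp]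
      · rw [LinearMap.mem_ker, sandwich_apply]
        refine Eq.trans ?_ h0
        rw [subseq_succ θ (Nat.zero_le p), Matrix.mul_assoc, Matrix.mul_assoc, Matrix.mul_assoc]
    · obtain ⟨rfl, rfl⟩ : l = L ∧ h = 0 := by omega
      exact tau_le_sSup h₅ h₄ h₃ (Submodule.mem_map_of_mem huv)
  refine mem_of_col_le (S := S) (U := ⊤) (fun u _ v => ?_) (fun _ => Submodule.mem_top)
  refine top_le_of_prebasis_left hab hp.le (S := S.comap (vecMulVecLeft _ v))
    (fun l i h₁ h₂ h₃ u hu => ?_) (Submodule.mem_top (x := u))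
  exact top_le_of_prebasis_right hab hp.le (S := S.comap (vecMulVecRight _ u))
    (fun k h h₄ h₅ h₆ v hv => hS l i h₁ h₂ h₃ k h h₄ h₅ h₆ u hu v hv)
    (Submodule.mem_top (x := v))

/-- The freedom prebasis spans the nullspace of `dμ(θ)`. -/
lemma sSup_thetaFree (hab : IsPrebasisChoice θ a b) : sSup (thetaFree θ a b) = nullDmu θ := by
  refine le_antisymm (sSup_le fun X hX Δ hΔ => ?_) (nullDmu_le θ _
    (fun p M hM => single_mem_sSup_thetaFree hab p hM)
    (twoMatrixTangent_mem_sSup_thetaFree hab))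
  by_cases h0 : Δ = 0
  · rw [h0]; exact Submodule.zero_mem _
  -- The nullspace depends neither on the fiber's label nor on the smoothness order, so `W = μ(θ)`
  -- and order `1` serve.
  have hθ : θ ∈ fiber (mu θ) := rfl
  rcases hX with hX | hX
  · exact directions_subset_nullDmu
      (isOneMatrixDirection_of_mem_thetaOFiber hθ 1 hab hX hΔ h0).mem_directions
  · exact directions_subset_nullDmu
      (isTwoMatrixDirection_of_mem_thetaTL0 hθ 1 hX hΔ h0).mem_directions

end Generation

end LinearNetwork

end

open LinearNetwork in
theorem mainTheorem8 (L : ℕ) (d : ℕ → ℕ) (W : Matrix (Fin (d L)) (Fin (d 0)) ℝ)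
    (θ : Weights L d) (hθ : θ ∈ fiber W) (n : WithTop ℕ∞) (hn : 1 ≤ n) :
    -- the directions by which a smooth path can leave `θ` on the fiber span the nullspace
    Submodule.span ℝ (directions n W θ) = nullDmu θ ∧
    -- the maximum number of linearly independent such directions is `D^free`
    IsGreatest {m : ℤ | ∃ s : Finset (Weights L d), (s.card : ℤ) = m ∧
      (s : Set (Weights L d)) ⊆ directions n W θ ∧
      LinearIndepOn ℝ id (s : Set (Weights L d))} (dFree θ) ∧
    -- the directions in the freedom prebasis are directions of straight one-matrix lines and of
    -- two-matrix paths, and they suffice to span the nullspace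
    ∀ a b : ℕ → (j : ℕ) → ℕ → Submodule ℝ (Fin (d j) → ℝ), IsPrebasisChoice θ a b →
      (∀ X ∈ thetaOFiber L a b, ∀ Δ ∈ X, Δ ≠ 0 → IsOneMatrixDirection n W θ Δ) ∧
      (∀ X ∈ thetaTL0 θ a b, ∀ Δ ∈ X, Δ ≠ 0 → IsTwoMatrixDirection n W θ Δ) ∧
      sSup (thetaFree θ a b) = nullDmu θ ∧
      (Module.finrank ℝ (sSup (thetaFree θ a b) : Submodule ℝ (Weights L d)) : ℤ) = dFree θ := by
  have hspan := span_directions hθ n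
  refine ⟨hspan, ?_, fun a b hab => ⟨?_, ?_, sSup_thetaFree hab, ?_⟩⟩
  · have h := isGreatest_card_linearIndepOn (directions n W θ)
    rwa [hspan, finrank_nullDmu] at h
  · exact fun X hX Δ hΔ h0 => isOneMatrixDirection_of_mem_thetaOFiber hθ n hab hX hΔ h0
  · exact fun X hX Δ hΔ h0 => isTwoMatrixDirection_of_mem_thetaTL0 hθ n hX hΔ h0
  · rw [sSup_thetaFree hab, finrank_nullDmu]
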